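/- Let $k$ be a field with a (possibly trivial) involution $c\mapsto\bar c$. The Leavitt algebra $L_k(1,2)$ is the unital $k$-algebra with generators $x_1,x_2,x_1^*,x_2^*$ and relations $x_1x_1^*+x_2x_2^*=1$, $x_i^*x_j=\delta_{ij}1$. For a directed graph $E=(E^0,E^1,s,r)$, the Leavitt path algebra $L_k(E)$ is the (not necessarily unital) $k$-algebra with generators $v$ ($v\in E^0$), $e,e^*$ ($e\in E^1$) and relations $vw=\delta_{v,w}v$; $s(e)e=e=e\,r(e)$ and $r(e)e^*=e^*=e^*s(e)$; $e^*f=\delta_{e,f}r(e)$; and $v=\sum_{s(e)=v}ee^*$ for every $v$ with $0<|s^{-1}(v)|<\infty$. Both are $*$-algebras, with $v^*=v$, with $*$ exchanging $e\leftrightarrow e^*$ and $x_i\leftrightarrow x_i^*$ and acting on scalars by $c\mapsto\bar c$. Both carry the standard $\mathbb Z$-grading, with $\deg v=0$, $\deg e=\deg x_i=1$, $\deg e^*=\deg x_i^*=-1$. The $*$-algebra $L_k(1,2)\otimes_k L_k(1,2)$ is graded by the standard grading on the first factor and the trivial grading on the second: its degree $n$ component is $L_k(1,2)_n\otimes L_k(1,2)$.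 **Theorem 4.3.** Let $E$ be a row-finite countable graph (every vertex emits finitely many edges; $E^0$ and $E^1$ are countable). Then there is an injective grading-preserving $*$-homomorphism of $k$-algebras $$\psi\colon L_k(E)\hookrightarrow L_k(1,2)\otimes_k L_k(1,2).$$ More precisely, there are an injective $*$-homomorphism of $k$-algebras $\varphi\colon L_k(E)\hookrightarrow L_k(1,2)$, elements $u_v$ ($v\in E^0$) of degree $1$ in $L_k(1,2)\otimes_k L_k(1,2)$ with $$(1\otimes\varphi(v))u_v=u_v=u_v(1\otimes\varphi(v)),\qquad u_v^*u_v=u_vu_v^*=1\otimes\varphi(v),$$ and a $\psi$ as above such that $\psi(v)=1\otimes\varphi(v)$ for all $v\in E^0$ and $\psi(e)=u_{s(e)}(1\otimes\varphi(e))$ for all $e\in E^1$. If $E^0$ is finite, these can moreover be chosen such that $\sum_{v\in E^0}\varphi(v)=1$ (when $E^0\neq\emptyset$) and such that there is a unitary $u$ of degree $1$ in $L_k(1,2)\otimes_k L_k(1,2)$ commuting with all $1\otimes\varphi(v)$ and satisfying $\psi(e)=u(1\otimes\varphi(e))$ for all $e\in E^1$. -/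

import Mathlib

open scoped TensorProduct

universe u v w

section FreeStar

variable (k : Type u) [CommRing k] [StarRing k] {X : Type v}

/-- The conjugate-linear anti-endomorphism of the free unital algebra `k⟨X⟩` extending a map
`σ` of the letters: `c x₁ ⋯ xₙ ↦ star c · σ(xₙ) ⋯ σ(x₁)`.  (It is an algebra map into the opposite
algebra, on which `k` acts through `star`.) -/
noncomputable def freeStarHom (σ : X → X) : FreeAlgebra k X →+* (FreeAlgebra k X)ᵐᵒᵖ :=
  letI : Algebra k (FreeAlgebra k X)ᵐᵒᵖ :=
    ((algebraMap k (FreeAlgebra k X)ᵐᵒᵖ).comp (starRingEnd k)).toAlgebra'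
      (fun c x => Algebra.commutes (starRingEnd k c) x)
  (FreeAlgebra.lift k (fun x => MulOpposite.op (FreeAlgebra.ι k (σ x))) :
    FreeAlgebra k X →ₐ[k] (FreeAlgebra k X)ᵐᵒᵖ).toRingHom

theorem freeStarHom_ι (σ : X → X) (x : X) :
    freeStarHom k σ (FreeAlgebra.ι k x) = MulOpposite.op (FreeAlgebra.ι k (σ x)) := by
  let _ : Algebra k (FreeAlgebra k X)ᵐᵒᵖ :=
    ((algebraMap k (FreeAlgebra k X)ᵐᵒᵖ).comp (starRingEnd k)).toAlgebra'
      (fun c x => Algebra.commutes (starRingEnd k c) x)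
  exact FreeAlgebra.lift_ι_apply (A := (FreeAlgebra k X)ᵐᵒᵖ)
    (fun x => MulOpposite.op (FreeAlgebra.ι k (σ x))) x

theorem freeStarHom_algebraMap (σ : X → X) (c : k) :
    freeStarHom k σ (algebraMap k _ c) = MulOpposite.op (algebraMap k _ (star c)) := by
  let _ : Algebra k (FreeAlgebra k X)ᵐᵒᵖ :=
    ((algebraMap k (FreeAlgebra k X)ᵐᵒᵖ).comp (starRingEnd k)).toAlgebra'
      (fun c x => Algebra.commutes (starRingEnd k c) x)
  exact AlgHom.commutes (FreeAlgebra.lift k (fun x => MulOpposite.op (FreeAlgebra.ι k (σ x))) :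
    FreeAlgebra k X →ₐ[k] (FreeAlgebra k X)ᵐᵒᵖ) c

/-- The involution of the free unital algebra `k⟨X⟩` extending an involution of the letters. -/
@[reducible] noncomputable def freeStarRing (σ : X → X) (hσ : Function.Involutive σ) :
    StarRing (FreeAlgebra k X) where
  star a := (freeStarHom k σ a).unop
  star_involutive a := by
    change (freeStarHom k σ (freeStarHom k σ a).unop).unop = a
    induction a with
    | grade0 c => simp [freeStarHom_algebraMap]
    | grade1 x => simp [freeStarHom_ι, hσ x]
    | mul a b ha hb => simp [ha, hb]
    | add a b ha hb => simp [ha, hb]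
  star_mul a b := by simp
  star_add a b := by simp

end FreeStar

section Leavitt

/-- Generators of the Leavitt algebra `L(1,2)`: `x i` and `xs i` (`= xᵢ*`), `i = 0, 1`. -/
inductive LeavittGen : Type
  | x (i : Fin 2)
  | xs (i : Fin 2)

namespace LeavittGen

/-- The involution `xᵢ ↔ xᵢ*` of the generators. -/
def flip : LeavittGen → LeavittGen
  | x i => xs i
  | xs i => x i

theorem flip_flip : Function.Involutive flip := by
  rintro (i | i) <;> rfl

/-- The standard degrees of the generators. -/
def deg : LeavittGen → ℤ
  | x _ => 1
  | xs _ => -1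

end LeavittGen

variable (k : Type u) [CommRing k]

/-- The defining relations `x₀x₀* + x₁x₁* = 1` and `xᵢ*xⱼ = δᵢⱼ` of `L(1,2)`. -/
inductive LeavittRel : FreeAlgebra k LeavittGen → FreeAlgebra k LeavittGen → Prop
  | sum : LeavittRel (∑ i : Fin 2, FreeAlgebra.ι k (.x i) * FreeAlgebra.ι k (.xs i)) 1
  | self (i : Fin 2) : LeavittRel (FreeAlgebra.ι k (.xs i) * FreeAlgebra.ι k (.x i)) 1
  | ne (i j : Fin 2) (h : i ≠ j) :
      LeavittRel (FreeAlgebra.ι k (.xs i) * FreeAlgebra.ι k (.x j)) 0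

/-- The Leavitt algebra `L_k(1,2)`, a unital `k`-algebra. -/
def Leavitt : Type u := RingQuot (LeavittRel k)

namespace Leavitt

noncomputable instance : Ring (Leavitt k) := inferInstanceAs (Ring (RingQuot (LeavittRel k)))

noncomputable instance : Algebra k (Leavitt k) :=
  inferInstanceAs (Algebra k (RingQuot (LeavittRel k)))

/-- The quotient map onto `L_k(1,2)`. -/
noncomputable def mk : FreeAlgebra k LeavittGen →ₐ[k] Leavitt k :=
  RingQuot.mkAlgHom k (LeavittRel k)

/-- The image of a generator in `L_k(1,2)`. -/
noncomputable def gen (g : LeavittGen) : Leavitt k := mk k (FreeAlgebra.ι k g)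

/-- The degree `n` component of the standard `ℤ`-grading: the span of the words of degree `n` in
the generators. -/
noncomputable def component (n : ℤ) : Submodule k (Leavitt k) :=
  Submodule.span k {a | ∃ l : List LeavittGen,
    (l.map LeavittGen.deg).sum = n ∧ a = (l.map (gen k)).prod}

variable [StarRing k]

theorem rel_star (a b : FreeAlgebra k LeavittGen) (h : LeavittRel k a b) :
    LeavittRel k (freeStarHom k LeavittGen.flip a).unop
      (freeStarHom k LeavittGen.flip b).unop := by
  cases h with
  | sum =>
    simpa [freeStarHom_ι, LeavittGen.flip] using LeavittRel.sum (k := k)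
  | self i =>
    simpa [freeStarHom_ι, LeavittGen.flip] using LeavittRel.self (k := k) i
  | ne i j h =>
    simpa [freeStarHom_ι, LeavittGen.flip] using LeavittRel.ne (k := k) j i h.symm

/-- The standard involution of `L_k(1,2)`: `xᵢ ↔ xᵢ*`, `c ↦ star c` on scalars. -/
noncomputable instance : StarRing (Leavitt k) :=
  @RingQuot.starRing (FreeAlgebra k LeavittGen) _
    (freeStarRing k LeavittGen.flip LeavittGen.flip_flip) (LeavittRel k) (rel_star k)

theorem star_mk (a : FreeAlgebra k LeavittGen) :
    star (mk k a) = mk k (freeStarHom k LeavittGen.flip a).unop := by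
  have h : ∀ b, mk k b = (⟨Quot.mk _ b⟩ : RingQuot (LeavittRel k)) := by
    intro b
    simp only [mk, RingQuot.mkAlgHom_def, RingQuot.mkRingHom_def]
    rfl
  rw [h, h]
  rfl

theorem star_gen (g : LeavittGen) : star (gen k g) = gen k g.flip := by
  simp [gen, star_mk, freeStarHom_ι]

instance : StarModule k (Leavitt k) where
  star_smul c a := by
    have h : star (algebraMap k (Leavitt k) c) = algebraMap k (Leavitt k) (star c) := by
      have h1 := star_mk k (algebraMap k _ c)
      rw [freeStarHom_algebraMap, MulOpposite.unop_op, AlgHom.commutes, AlgHom.commutes] at h1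
      exact h1
    rw [Algebra.smul_def, Algebra.smul_def, star_mul, h, Algebra.commutes]

end Leavitt

/-- The degree `n` component of `L_k(1,2) ⊗ L_k(1,2)` for the grading induced by the standard
`ℤ`-grading of the first factor and the trivial grading of the second factor. -/
noncomputable def tensorComponent (n : ℤ) : Submodule k (Leavitt k ⊗[k] Leavitt k) :=
  Submodule.span k {t | ∃ a ∈ Leavitt.component k n, ∃ b : Leavitt k, t = a ⊗ₜ[k] b}

end Leavitt

/-- A directed graph with vertex set `V`, edge set `E`, source and range maps. -/
structure DiGraph (V : Type v) (E : Type w) where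
  src : E → V
  rng : E → V

/-- Every vertex emits only finitely many edges. -/
def DiGraph.RowFinite {V : Type v} {E : Type w} (G : DiGraph V E) : Prop :=
  ∀ v, {e | G.src e = v}.Finite

section LeavittPath

/-- Generators of a Leavitt path algebra: vertices `v`, edges `e` and ghost edges `e*`. -/
inductive PathGen (V : Type v) (E : Type w) : Type (max v w)
  | vert (v : V)
  | edge (e : E)
  | ghost (e : E)

namespace PathGen

variable {V : Type v} {E : Type w}

/-- The involution `v ↦ v`, `e ↔ e*` of the generators. -/
def flip : PathGen V E → PathGen V E
  | vert v => vert v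
  | edge e => ghost e
  | ghost e => edge e

theorem flip_flip : Function.Involutive (flip : PathGen V E → PathGen V E) := by
  rintro (v | e | e) <;> rfl

/-- The standard degrees of the generators. -/
def deg : PathGen V E → ℤ
  | vert _ => 0
  | edge _ => 1
  | ghost _ => -1

end PathGen

variable (k : Type u) [CommRing k] {V : Type v} {E : Type w} (G : DiGraph V E)

/-- The defining relations of the Leavitt path algebra:
(1) `v w = δ_{v,w} w`; (2) `s(e) e = e = e r(e)`, `r(e) e* = e* = e* s(e)`;
(3) `e* f = δ_{e,f} r(e)`; (4) `v = ∑_{s(e) = v} e e*` for every regular vertex `v`,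
i.e. whenever `s⁻¹(v)` is finite and non-empty. -/
inductive PathRel : FreeAlgebra k (PathGen V E) → FreeAlgebra k (PathGen V E) → Prop
  | vert_self (v : V) : PathRel
      (FreeAlgebra.ι k (.vert v) * FreeAlgebra.ι k (.vert v)) (FreeAlgebra.ι k (.vert v))
  | vert_ne (v w : V) (h : v ≠ w) : PathRel
      (FreeAlgebra.ι k (.vert v) * FreeAlgebra.ι k (.vert w)) 0
  | src_edge (e : E) : PathRel
      (FreeAlgebra.ι k (.vert (G.src e)) * FreeAlgebra.ι k (.edge e)) (FreeAlgebra.ι k (.edge e))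
  | edge_rng (e : E) : PathRel
      (FreeAlgebra.ι k (.edge e) * FreeAlgebra.ι k (.vert (G.rng e))) (FreeAlgebra.ι k (.edge e))
  | rng_ghost (e : E) : PathRel
      (FreeAlgebra.ι k (.vert (G.rng e)) * FreeAlgebra.ι k (.ghost e)) (FreeAlgebra.ι k (.ghost e))
  | ghost_src (e : E) : PathRel
      (FreeAlgebra.ι k (.ghost e) * FreeAlgebra.ι k (.vert (G.src e))) (FreeAlgebra.ι k (.ghost e))
  | ghost_edge_self (e : E) : PathRel
      (FreeAlgebra.ι k (.ghost e) * FreeAlgebra.ι k (.edge e)) (FreeAlgebra.ι k (.vert (G.rng e)))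
  | ghost_edge_ne (e f : E) (h : e ≠ f) : PathRel
      (FreeAlgebra.ι k (.ghost e) * FreeAlgebra.ι k (.edge f)) 0
  | regular (v : V) (hfin : {e | G.src e = v}.Finite) (hne : {e | G.src e = v}.Nonempty) : PathRel
      (∑ e ∈ hfin.toFinset, FreeAlgebra.ι k (.edge e) * FreeAlgebra.ι k (.ghost e))
      (FreeAlgebra.ι k (.vert v))

/-- The unital `k`-algebra with the generators and relations of the Leavitt path algebra.  As the
relations have no constant term, this is the Leavitt path algebra with a unit adjoined. -/
def PathUnital : Type (max u v w) := RingQuot (PathRel k G)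

namespace PathUnital

noncomputable instance : Ring (PathUnital k G) :=
  inferInstanceAs (Ring (RingQuot (PathRel k G)))

noncomputable instance : Algebra k (PathUnital k G) :=
  inferInstanceAs (Algebra k (RingQuot (PathRel k G)))

/-- The quotient map. -/
noncomputable def mk : FreeAlgebra k (PathGen V E) →ₐ[k] PathUnital k G :=
  RingQuot.mkAlgHom k (PathRel k G)

/-- The image of a generator. -/
noncomputable def gen (g : PathGen V E) : PathUnital k G := mk k G (FreeAlgebra.ι k g)

variable [StarRing k]

theorem rel_star (a b : FreeAlgebra k (PathGen V E)) (h : PathRel k G a b) :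
    PathRel k G (freeStarHom k PathGen.flip a).unop (freeStarHom k PathGen.flip b).unop := by
  cases h with
  | vert_self v => simpa [freeStarHom_ι, PathGen.flip] using PathRel.vert_self (k := k) (G := G) v
  | vert_ne v w h =>
    simpa [freeStarHom_ι, PathGen.flip] using PathRel.vert_ne (k := k) (G := G) w v h.symm
  | src_edge e => simpa [freeStarHom_ι, PathGen.flip] using PathRel.ghost_src (k := k) (G := G) e
  | edge_rng e => simpa [freeStarHom_ι, PathGen.flip] using PathRel.rng_ghost (k := k) (G := G) e
  | rng_ghost e => simpa [freeStarHom_ι, PathGen.flip] using PathRel.edge_rng (k := k) (G := G) e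
  | ghost_src e => simpa [freeStarHom_ι, PathGen.flip] using PathRel.src_edge (k := k) (G := G) e
  | ghost_edge_self e =>
    simpa [freeStarHom_ι, PathGen.flip] using PathRel.ghost_edge_self (k := k) (G := G) e
  | ghost_edge_ne e f h =>
    simpa [freeStarHom_ι, PathGen.flip] using PathRel.ghost_edge_ne (k := k) (G := G) f e h.symm
  | regular v hfin hne =>
    simpa [freeStarHom_ι, PathGen.flip] using PathRel.regular (k := k) (G := G) v hfin hne

noncomputable instance : StarRing (PathUnital k G) :=
  @RingQuot.starRing (FreeAlgebra k (PathGen V E)) _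
    (freeStarRing k PathGen.flip PathGen.flip_flip) (PathRel k G) (rel_star k G)

theorem star_mk (a : FreeAlgebra k (PathGen V E)) :
    star (mk k G a) = mk k G (freeStarHom k PathGen.flip a).unop := by
  have h : ∀ b, mk k G b = (⟨Quot.mk _ b⟩ : RingQuot (PathRel k G)) := by
    intro b
    simp only [mk, RingQuot.mkAlgHom_def, RingQuot.mkRingHom_def]
    rfl
  rw [h, h]
  rfl

theorem star_gen (g : PathGen V E) : star (gen k G g) = gen k G g.flip := by
  simp [gen, star_mk, freeStarHom_ι]

instance : StarModule k (PathUnital k G) where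
  star_smul c a := by
    have h : star (algebraMap k (PathUnital k G) c) = algebraMap k (PathUnital k G) (star c) := by
      have h1 := star_mk k G (algebraMap k _ c)
      rw [freeStarHom_algebraMap, MulOpposite.unop_op, AlgHom.commutes, AlgHom.commutes] at h1
      exact h1
    rw [Algebra.smul_def, Algebra.smul_def, star_mul, h, Algebra.commutes]

end PathUnital

variable [StarRing k]

/-- The Leavitt path algebra `L_k(G)`: the (in general non-unital) `k`-algebra generated by all
`v`, `e`, `e*` subject to the relations (1)-(4).  It is realised inside the algebra with a unit
adjoined, as the non-unital subalgebra generated by the (star-closed) set of generators; see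
`LeavittPath.existsUnique_lift` for its universal property. -/
abbrev LeavittPath : Type (max u v w) :=
  NonUnitalStarAlgebra.adjoin k (Set.range (PathUnital.gen k G))

namespace LeavittPath

/-- The generators of `L_k(G)`. -/
noncomputable def gen (g : PathGen V E) : LeavittPath k G :=
  ⟨PathUnital.gen k G g, NonUnitalStarAlgebra.subset_adjoin k _ ⟨g, rfl⟩⟩

/-- The degree `n` component of the standard `ℤ`-grading: the span of the (non-empty) words of
degree `n` in the generators. -/
noncomputable def component (n : ℤ) : Submodule k (LeavittPath k G) :=
  Submodule.span k {a | ∃ l : List (PathGen V E), l ≠ [] ∧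
    (l.map PathGen.deg).sum = n ∧ (a : PathUnital k G) = (l.map (PathUnital.gen k G)).prod}

theorem star_gen (g : PathGen V E) : star (gen k G g) = gen k G g.flip :=
  Subtype.ext (PathUnital.star_gen k G g)

/-- The universal property: `L_k(G)` is the universal non-unital `k`-algebra with generators
`v`, `e`, `e*` and relations (1)-(4). -/
theorem existsUnique_lift {B : Type*} [NonUnitalRing B] [Module k B] [IsScalarTower k B B]
    [SMulCommClass k B B] (f : PathGen V E → B)
    (h1 : ∀ v, f (.vert v) * f (.vert v) = f (.vert v))
    (h2 : ∀ v w, v ≠ w → f (.vert v) * f (.vert w) = 0)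
    (h3 : ∀ e, f (.vert (G.src e)) * f (.edge e) = f (.edge e))
    (h4 : ∀ e, f (.edge e) * f (.vert (G.rng e)) = f (.edge e))
    (h5 : ∀ e, f (.vert (G.rng e)) * f (.ghost e) = f (.ghost e))
    (h6 : ∀ e, f (.ghost e) * f (.vert (G.src e)) = f (.ghost e))
    (h7 : ∀ e, f (.ghost e) * f (.edge e) = f (.vert (G.rng e)))
    (h8 : ∀ e e', e ≠ e' → f (.ghost e) * f (.edge e') = 0)
    (h9 : ∀ v (hfin : {e | G.src e = v}.Finite), {e | G.src e = v}.Nonempty →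
      ∑ e ∈ hfin.toFinset, f (.edge e) * f (.ghost e) = f (.vert v)) :
    ∃! F : LeavittPath k G →ₙₐ[k] B, ∀ g, F (gen k G g) = f g := by
  let L : PathUnital k G →ₐ[k] Unitization k B :=
    RingQuot.liftAlgHom k ⟨FreeAlgebra.lift k (fun g => (f g : Unitization k B)), by
      intro a b h
      cases h with
      | vert_self v => simp [← Unitization.inr_mul, h1]
      | vert_ne v w h => simp [← Unitization.inr_mul, h2 v w h]
      | src_edge e => simp [← Unitization.inr_mul, h3]
      | edge_rng e => simp [← Unitization.inr_mul, h4]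
      | rng_ghost e => simp [← Unitization.inr_mul, h5]
      | ghost_src e => simp [← Unitization.inr_mul, h6]
      | ghost_edge_self e => simp [← Unitization.inr_mul, h7]
      | ghost_edge_ne e e' h => simp [← Unitization.inr_mul, h8 e e' h]
      | regular v hfin hne =>
        simp only [map_sum, map_mul, FreeAlgebra.lift_ι_apply, ← Unitization.inr_mul,
          ← h9 v hfin hne]
        exact (map_sum (Unitization.inrNonUnitalAlgHom k B) _ _).symm⟩
  have hL : ∀ g, L (PathUnital.gen k G g) = (f g : Unitization k B) := by
    intro g
    exact (RingQuot.liftAlgHom_mkAlgHom_apply k _ _ _).trans (FreeAlgebra.lift_ι_apply _ _)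
  have hspan : ∀ x ∈ NonUnitalAlgebra.adjoin k (Set.range (PathUnital.gen k G)),
      (L x).fst = 0 := by
    intro x hx
    induction hx using NonUnitalAlgebra.adjoin_induction with
    | mem x hx => obtain ⟨g, rfl⟩ := hx; simp [hL]
    | add x y _ _ hx hy => simp [hx, hy]
    | zero => simp
    | mul x y _ _ hx hy => simp [hx, hy]
    | smul c x _ hx => simp [hx]
  have hset : (Set.range (PathUnital.gen k G)) ∪ star (Set.range (PathUnital.gen k G)) =
      Set.range (PathUnital.gen k G) := by
    refine Set.union_eq_self_of_subset_right ?_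
    rintro x ⟨g, hg⟩
    exact ⟨g.flip, by rw [← PathUnital.star_gen, hg, star_star]⟩
  have hiff : ∀ x : PathUnital k G,
      x ∈ NonUnitalStarAlgebra.adjoin k (Set.range (PathUnital.gen k G)) ↔
      x ∈ NonUnitalAlgebra.adjoin k (Set.range (PathUnital.gen k G)) := by
    intro x
    rw [← NonUnitalStarSubalgebra.mem_toNonUnitalSubalgebra,
      NonUnitalStarAlgebra.adjoin_toNonUnitalSubalgebra, hset]
  refine ⟨{ toFun := fun x => (L x).snd
            map_smul' := fun c x => by simp
            map_zero' := by simp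
            map_add' := fun x y => by simp
            map_mul' := fun x y => by
              simp [hspan _ ((hiff _).1 x.2), hspan _ ((hiff _).1 y.2)] },
    fun g => ?_, fun F hF => ?_⟩
  · change (L (PathUnital.gen k G g)).snd = f g
    simp [hL]
  · ext x
    obtain ⟨x, hx⟩ := x
    have hx' := (hiff x).1 hx
    change F ⟨x, hx⟩ = (L x).snd
    revert hx
    induction hx' using NonUnitalAlgebra.adjoin_induction with
    | mem x hx => obtain ⟨g, rfl⟩ := hx; intro hx; rw [hL]; exact hF g
    | zero => intro h; rw [map_zero]; exact map_zero F
    | add x y hx hy ihx ihy =>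
      intro h
      have := map_add F ⟨x, (hiff x).2 hx⟩ ⟨y, (hiff y).2 hy⟩
      simpa [ihx ((hiff x).2 hx), ihy ((hiff y).2 hy)] using this
    | mul x y hx hy ihx ihy =>
      intro h
      have := map_mul F ⟨x, (hiff x).2 hx⟩ ⟨y, (hiff y).2 hy⟩
      simpa [ihx ((hiff x).2 hx), ihy ((hiff y).2 hy), hspan _ hx, hspan _ hy] using this
    | smul c x hx ih =>
      intro h
      have := map_smul F c ⟨x, (hiff x).2 hx⟩
      simpa [ih ((hiff x).2 hx)] using this

end LeavittPath

end LeavittPath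

/-! Write `x`, `y` for the generators of `L(1,2)` with indices `0`, `1`. Choose isometries `s_v`
with orthogonal ranges, and isometries `t_e` such that those of the edges leaving one regular vertex
have orthogonal ranges adding up to `1`. Then `v ↦ s_v s_v*`, `e ↦ s_{s(e)} t_e s_{r(e)}*` is a
Cuntz–Krieger family (`isCKFamily_of_isometries`), which yields `φ`.

The difficulty is injectivity: `φ` need not be graded, and when a vertex emits a single edge its
`t_e` is a unitary, which for a loop must not satisfy a polynomial equation. So `t_e` is built with
`t_e x = x yⁱ x`, where `i` distinguishes edges with a common source (`expandingTuple`). Along a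
path the `t_e` then move `x` to `x` times a word in the letters `yⁱ x`. For distinct paths from one
vertex, the product of one word's adjoint with the other word is homogeneous of nonzero degree,
possibly zero, whereas each word is an isometry; compression followed by the degree-zero projection
therefore separates paths.

Independence of the images of paths is enough for injectivity (`injective_of_linearIndependent`).
Filter the algebra by the number of ghost edges: right multiplication of a kernel element `a` by an
edge removes a ghost edge, `a v = ∑ a e e*` recovers `a v` at a regular vertex, and at a sink only
combinations of paths survive.

For `ψ`, note that `∑ xᵢ ⊗ xᵢ*` is a unitary of degree `1`. Its copy `u_v = ∑ xᵢ ⊗ s_v xᵢ* s_v*` in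
the corner of `v` twists `1 ⊗ φ(e)` into a graded family, to which the same criterion applies:
distinct paths of equal length have orthogonal images, and different lengths give nonzero degree.
For finite nonempty `V` the corners fill the algebra, and the `u_v` add up to a unitary. -/

namespace Leavitt

/-! ### Relations, nontriviality and grading of `L(1,2)` -/

section Basic

variable (k : Type u) [CommRing k]

/-- The homomorphism out of `L_k(1,2)` given by images of the generators. -/
theorem exists_lift {B : Type*} [Ring B] [Algebra k B] (f : LeavittGen → B)
    (h1 : f (.x 0) * f (.xs 0) + f (.x 1) * f (.xs 1) = 1)
    (h2 : ∀ i, f (.xs i) * f (.x i) = 1) (h3 : ∀ i j, i ≠ j → f (.xs i) * f (.x j) = 0) :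
    ∃ F : Leavitt k →ₐ[k] B, ∀ g, F (gen k g) = f g := by
  refine ⟨RingQuot.liftAlgHom k ⟨FreeAlgebra.lift k f, ?_⟩, fun g => ?_⟩
  · intro a b h
    cases h with
    | sum => simp [Fin.sum_univ_two, h1]
    | self i => simp [h2]
    | ne i j h => simp [h3 i j h]
  · exact (RingQuot.liftAlgHom_mkAlgHom_apply k _ _ _).trans (FreeAlgebra.lift_ι_apply _ _)

theorem xs_mul_x_self (i : Fin 2) : gen k (.xs i) * gen k (.x i) = 1 := by
  simpa [gen] using! RingQuot.mkAlgHom_rel k (LeavittRel.self (k := k) i)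

theorem xs_mul_x_ne {i j : Fin 2} (h : i ≠ j) : gen k (.xs i) * gen k (.x j) = 0 := by
  simpa [gen] using! RingQuot.mkAlgHom_rel k (LeavittRel.ne (k := k) i j h)

theorem x_mul_xs_add :
    gen k (.x 0) * gen k (.xs 0) + gen k (.x 1) * gen k (.xs 1) = 1 := by
  simpa [gen, Fin.sum_univ_two] using! RingQuot.mkAlgHom_rel k (LeavittRel.sum (k := k))

/-- `L_k(1,2)` acts on sequences: `xᵢ` moves the entry at `n` to `2 n + i`. -/
theorem nontrivial [Nontrivial k] : Nontrivial (Leavitt k) := by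
  let f : LeavittGen → Module.End k (ℕ → k)
    | .x i =>
      { toFun := fun a n => if n % 2 = i then a (n / 2) else 0
        map_add' := fun a b => by ext n; dsimp only [Pi.add_apply]; split_ifs <;> simp
        map_smul' := fun c a => by ext n; simp }
    | .xs i =>
      { toFun := fun a n => a (2 * n + i)
        map_add' := fun a b => rfl
        map_smul' := fun c a => rfl }
  obtain ⟨F, -⟩ := exists_lift k f
    (by
      ext1 a
      funext n
      have h : ∀ i, n % 2 = i → 2 * (n / 2) + i = n := fun i hi => by omega
      rcases Nat.mod_two_eq_zero_or_one n with h0 | h0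
      · simpa [f, h0] using congrArg a (h 0 h0)
      · simpa [f, h0] using congrArg a (h 1 h0))
    (fun i => by
      ext1 a
      funext n
      have h1 : (2 * n + i.1) % 2 = i := by omega
      have h2 : (2 * n + i.1) / 2 = n := by omega
      simp [f, h1, h2])
    (fun i j hij => by
      ext1 a
      funext n
      have h1 : ¬ i.1 % 2 = j := by
        have : i.1 ≠ j.1 := fun h => hij (Fin.ext h)
        omega
      simp [f, h1])
  have : Nontrivial (Module.End k (ℕ → k)) := inferInstance
  exact F.toRingHom.domain_nontrivial

theorem one_mem_component : (1 : Leavitt k) ∈ component k 0 :=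
  Submodule.subset_span ⟨[], rfl, rfl⟩

theorem gen_mem_component (g : LeavittGen) : gen k g ∈ component k g.deg :=
  Submodule.subset_span ⟨[g], by simp, by simp⟩

theorem mul_mem_component {m n : ℤ} {a b : Leavitt k} (ha : a ∈ component k m)
    (hb : b ∈ component k n) : a * b ∈ component k (m + n) := by
  have h := Submodule.mul_mem_mul ha hb
  rw [component, component, Submodule.span_mul_span] at h
  refine Submodule.span_mono ?_ h
  rintro _ ⟨_, ⟨l, hl, rfl⟩, _, ⟨l', hl', rfl⟩, rfl⟩
  exact ⟨l ++ l', by simp [hl, hl'], by simp⟩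

/-- The projection onto the degree `0` component. -/
theorem exists_proj : ∃ π : Leavitt k →ₗ[k] Leavitt k, (∀ a ∈ component k 0, π a = a) ∧
    ∀ n ≠ 0, ∀ a ∈ component k n, π a = 0 := by
  -- Scaling each generator by `T ^ deg` respects the relations. The resulting map to the Laurent
  -- polynomials over `L(1,2)` sends a homogeneous `a` of degree `n` to `a Tⁿ`, so its coefficient
  -- at `0` is the projection.
  obtain ⟨F, hF⟩ := exists_lift k
    (fun g => (AddMonoidAlgebra.single g.deg (gen k g) : AddMonoidAlgebra (Leavitt k) ℤ))
    (by simp [-LaurentPolynomial.single_eq_C_mul_T, AddMonoidAlgebra.single_mul_single, LeavittGen.deg, ← AddMonoidAlgebra.single_add,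
          x_mul_xs_add, AddMonoidAlgebra.one_def])
    (by simp [-LaurentPolynomial.single_eq_C_mul_T, AddMonoidAlgebra.single_mul_single, LeavittGen.deg, xs_mul_x_self,
          AddMonoidAlgebra.one_def])
    (fun i j h => by
      simp [-LaurentPolynomial.single_eq_C_mul_T, AddMonoidAlgebra.single_mul_single, LeavittGen.deg, xs_mul_x_ne k h])
  have hC : ∀ n, ∀ a ∈ component k n, F a = AddMonoidAlgebra.single n a := by
    intro n a ha
    induction ha using Submodule.span_induction with
    | mem a ha =>
      obtain ⟨l, rfl, rfl⟩ := ha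
      induction l with
      | nil => simp [-LaurentPolynomial.single_eq_C_mul_T, AddMonoidAlgebra.one_def]
      | cons g l ih =>
        simp [-LaurentPolynomial.single_eq_C_mul_T, hF, ih, AddMonoidAlgebra.single_mul_single]
    | zero => simp
    | add a b _ _ ha hb =>
      simp [-LaurentPolynomial.single_eq_C_mul_T, ha, hb, AddMonoidAlgebra.single_add]
    | smul c a _ ha => simp [-LaurentPolynomial.single_eq_C_mul_T, ha]
  let π : Leavitt k →ₗ[k] Leavitt k :=
    { toFun := fun a => (F a).coeff 0
      map_add' := fun a b => by simp
      map_smul' := fun c a => by simp }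
  refine ⟨π, fun a ha => ?_, fun n hn a ha => ?_⟩
  · change (F a).coeff 0 = a
    simp [-LaurentPolynomial.single_eq_C_mul_T, hC _ _ ha]
  · change (F a).coeff 0 = 0
    simp [-LaurentPolynomial.single_eq_C_mul_T, hC _ _ ha, hn]

end Basic

/-! ### The grading of the tensor product -/

section Tensor

variable {k : Type u} [CommRing k]

theorem tmul_mem_tensorComponent {n : ℤ} {a : Leavitt k} (ha : a ∈ component k n)
    (b : Leavitt k) : a ⊗ₜ[k] b ∈ tensorComponent k n :=
  Submodule.subset_span ⟨a, ha, b, rfl⟩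

theorem mul_mem_tensorComponent {m n : ℤ} {a b : Leavitt k ⊗[k] Leavitt k}
    (ha : a ∈ tensorComponent k m) (hb : b ∈ tensorComponent k n) :
    a * b ∈ tensorComponent k (m + n) := by
  have h := Submodule.mul_mem_mul ha hb
  rw [tensorComponent, tensorComponent, Submodule.span_mul_span] at h
  refine Submodule.span_mono ?_ h
  rintro _ ⟨_, ⟨a, ha, b, rfl⟩, _, ⟨a', ha', b', rfl⟩, rfl⟩
  exact ⟨a * a', mul_mem_component k ha ha', b * b', by simp⟩

theorem exists_tensor_proj : ∃ π : (Leavitt k ⊗[k] Leavitt k) →ₗ[k] (Leavitt k ⊗[k] Leavitt k),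
    (∀ a ∈ tensorComponent k 0, π a = a) ∧ ∀ n ≠ 0, ∀ a ∈ tensorComponent k n, π a = 0 := by
  obtain ⟨π, h0, h1⟩ := exists_proj k
  refine ⟨π.rTensor (Leavitt k), fun a ha => ?_, fun n hn a ha => ?_⟩
  · induction ha using Submodule.span_induction with
    | mem a ha => obtain ⟨a, ha, b, rfl⟩ := ha; simp [h0 a ha]
    | zero => simp
    | add a b _ _ ha hb => simp [ha, hb]
    | smul c a _ ha => simp [ha]
  · induction ha using Submodule.span_induction with
    | mem a ha => obtain ⟨a, ha, b, rfl⟩ := ha; simp [h1 n hn a ha]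
    | zero => simp
    | add a b _ _ ha hb => simp [ha, hb]
    | smul c a _ ha => simp [ha]

variable [StarRing k]

theorem star_mem_component {n : ℤ} {a : Leavitt k} (ha : a ∈ component k n) :
    star a ∈ component k (-n) := by
  induction ha using Submodule.span_induction with
  | mem a ha =>
    obtain ⟨l, rfl, rfl⟩ := ha
    induction l with
    | nil => simpa using one_mem_component k
    | cons g l ih =>
      have hg : g.flip.deg = -g.deg := by cases g <;> rfl
      have h := mul_mem_component k ih (gen_mem_component k g.flip)
      rw [hg] at h
      simpa [star_gen] using h
  | zero => simp
  | add a b _ _ ha hb => simpa using add_mem ha hb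
  | smul c a _ ha => simpa using Submodule.smul_mem _ _ ha

theorem star_mem_tensorComponent {n : ℤ} {a : Leavitt k ⊗[k] Leavitt k}
    (ha : a ∈ tensorComponent k n) : star a ∈ tensorComponent k (-n) := by
  induction ha using Submodule.span_induction with
  | mem a ha =>
    obtain ⟨a, ha, b, rfl⟩ := ha
    simpa using tmul_mem_tensorComponent (star_mem_component ha) (star b)
  | zero => simp
  | add a b _ _ ha hb => simpa using add_mem ha hb
  | smul c a _ ha => simpa using Submodule.smul_mem _ _ ha

end Tensor

end Leavitt

/-! ### Families of isometries built from a Cuntz pair -/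

section Isometries

variable {R : Type*} [Ring R] [StarRing R]

/-- Two elements of a unital `*`-ring satisfying the relations of the generators of `L(1,2)`. -/
structure IsCuntzPair (x y : R) : Prop where
  star_left : star x * x = 1
  star_right : star y * y = 1
  orthogonal : star x * y = 0
  complete : x * star x + y * star y = 1

namespace IsCuntzPair

variable {x y : R} (h : IsCuntzPair x y)
include h

theorem orthogonal' : star y * x = 0 := by
  simpa using congrArg star h.orthogonal

theorem star_left_mul (c : R) : star x * (x * c) = c := by
  rw [← mul_assoc, h.star_left, one_mul]

theorem star_right_mul (c : R) : star y * (y * c) = c := by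
  rw [← mul_assoc, h.star_right, one_mul]

theorem orthogonal_mul (c : R) : star x * (y * c) = 0 := by
  rw [← mul_assoc, h.orthogonal, zero_mul]

theorem orthogonal_mul' (c : R) : star y * (x * c) = 0 := by
  rw [← mul_assoc, h.orthogonal', zero_mul]

theorem star_pow_mul_pow (n : ℕ) (c : R) : star y ^ n * (y ^ n * c) = c := by
  induction n generalizing c with
  | zero => simp
  | succ n ih => rw [pow_succ, pow_succ', mul_assoc, mul_assoc, h.star_right_mul, ih]

theorem star_branch_mul_self (i : ℕ) : star (y ^ i * x) * (y ^ i * x) = 1 := by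
  rw [star_mul, star_pow, mul_assoc, h.star_pow_mul_pow, h.star_left]

theorem star_branch_mul_pow {i m : ℕ} (him : i < m) : star (y ^ i * x) * y ^ m = 0 := by
  obtain ⟨d, rfl⟩ := Nat.exists_eq_add_of_lt him
  rw [star_mul, star_pow, add_assoc, pow_add, mul_assoc, h.star_pow_mul_pow, pow_succ',
    h.orthogonal_mul]

theorem star_branch_mul_ne {i j : ℕ} (hij : i ≠ j) : star (y ^ i * x) * (y ^ j * x) = 0 := by
  wlog hlt : i < j generalizing i j
  · simpa using congrArg star (this hij.symm (by omega))
  rw [← mul_assoc, h.star_branch_mul_pow hlt, zero_mul]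

/-- Induction refines the last range projection, that of `yᵐ`, by inserting `x x* + y y* = 1` in the
middle. -/
theorem sum_branch (m : ℕ) :
    ∑ i ∈ Finset.range m, y ^ i * x * star (y ^ i * x) + y ^ m * star (y ^ m) = 1 := by
  induction m with
  | zero => simp
  | succ m ih =>
    rw [Finset.sum_range_succ, ← ih, add_assoc]
    congr 1
    calc y ^ m * x * star (y ^ m * x) + y ^ (m + 1) * star (y ^ (m + 1))
        = y ^ m * (x * star x + y * star y) * star (y ^ m) := by
          simp only [star_mul, star_pow, pow_succ]
          noncomm_ring
      _ = _ := by rw [h.complete, mul_one]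

omit h [StarRing R] in
variable (x y) in
/-- The word `yⁱ x` for `i < m`, and `yᵐ` otherwise; for `0 ≤ i ≤ m` these are isometries with
orthogonal ranges which add up to `1`. -/
def tuple (m i : ℕ) : R := if i < m then y ^ i * x else y ^ m

theorem star_tuple_mul_self (m i : ℕ) : star (tuple x y m i) * tuple x y m i = 1 := by
  unfold tuple
  split_ifs
  · exact h.star_branch_mul_self i
  · simpa using h.star_pow_mul_pow m 1

theorem star_tuple_mul_ne {m i j : ℕ} (hi : i < m + 1) (hj : j < m + 1) (hij : i ≠ j) :
    star (tuple x y m i) * tuple x y m j = 0 := by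
  unfold tuple
  split_ifs with h1 h2 h2
  · exact h.star_branch_mul_ne hij
  · exact h.star_branch_mul_pow h1
  · simpa using congrArg star (h.star_branch_mul_pow h2)
  -- Neither index is below `m`, so both equal `m`, contradicting `i ≠ j`.
  · omega

theorem sum_tuple (m : ℕ) :
    ∑ i ∈ Finset.range (m + 1), tuple x y m i * star (tuple x y m i) = 1 := by
  rw [Finset.sum_range_succ, ← h.sum_branch m]
  congr 1
  · refine Finset.sum_congr rfl fun i hi => ?_
    simp [tuple, Finset.mem_range.1 hi]
  · simp [tuple]

omit h in
variable (x y) in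
/-- For `0 ≤ i ≤ m` these are again isometries with orthogonal ranges which add up to `1`; on the
range of `x` they act by `x w ↦ x yⁱ x w`. -/
def expandingTuple (m i : ℕ) : R :=
  x * (y ^ i * x) * star x +
    (x * y ^ (m + 1) * star x + y * star y) * tuple x y m i * star y

theorem expandingTuple_mul (m i : ℕ) :
    expandingTuple x y m i * x = x * (y ^ i * x) := by
  simp only [expandingTuple, add_mul, mul_assoc, h.star_left, h.orthogonal', mul_one, mul_zero,
    add_zero]

/-- The corner is an isometry onto the complement of the ranges of `x yⁱ x`, `i ≤ m`. It makes room
for the parts of the expanding tuple living on the range of `y`. -/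
theorem star_corner_mul (m : ℕ) :
    star (x * y ^ (m + 1) * star x + y * star y) * (x * y ^ (m + 1) * star x + y * star y) = 1 := by
  simp only [star_add, star_mul, star_star, star_pow, add_mul, mul_add, mul_assoc,
    h.star_left_mul, h.star_right_mul, h.orthogonal_mul, h.orthogonal_mul', h.star_pow_mul_pow,
    mul_zero, add_zero, zero_add, h.complete]

theorem corner_mul_star (m : ℕ) :
    (x * y ^ (m + 1) * star x + y * star y) * star (x * y ^ (m + 1) * star x + y * star y) =
      x * (y ^ (m + 1) * star (y ^ (m + 1))) * star x + y * star y := by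
  simp only [star_add, star_mul, star_star, star_pow, add_mul, mul_add, mul_assoc,
    h.star_left_mul, h.star_right_mul, h.orthogonal_mul, h.orthogonal_mul',
    mul_zero, add_zero, zero_add]

theorem star_branch_mul_corner {m i : ℕ} (hi : i < m + 1) :
    star (x * (y ^ i * x)) * (x * y ^ (m + 1) * star x + y * star y) = 0 := by
  rw [star_mul, mul_add]
  simp only [mul_assoc, h.star_left_mul, h.orthogonal_mul, mul_zero, add_zero]
  rw [← mul_assoc, h.star_branch_mul_pow hi, zero_mul]

/-- The cross terms vanish because the corner is orthogonal to every `x yⁱ x`. What remains is block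
diagonal for `1 = x x* + y y*`, so the relations of the branches and of `tuple` transfer together.
-/
theorem star_expandingTuple_mul {m i j : ℕ} (hi : i < m + 1) (hj : j < m + 1) :
    star (expandingTuple x y m i) * expandingTuple x y m j =
      x * (star (y ^ i * x) * (y ^ j * x)) * star x +
        y * (star (tuple x y m i) * tuple x y m j) * star y := by
  unfold expandingTuple
  have h1 := h.star_branch_mul_corner hi
  have h2 := congrArg star (h.star_branch_mul_corner hj)
  have h3 := h.star_corner_mul m
  set c := x * y ^ (m + 1) * star x + y * star y
  set a := tuple x y m i
  set b := tuple x y m j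
  set p := y ^ i * x
  set q := y ^ j * x
  rw [star_zero, star_mul, star_star] at h2
  calc star (x * p * star x + c * a * star y) * (x * q * star x + c * b * star y)
      = x * star p * (star x * x) * q * star x + x * (star (x * p) * c) * b * star y
        + y * star a * (star c * (x * q)) * star x + y * star a * (star c * c) * b * star y := by
        simp only [star_add, star_mul, star_star]
        noncomm_ring
    _ = _ := by
        rw [h1, h2, h3, h.star_left]
        noncomm_ring

theorem star_expandingTuple_mul_self {m i : ℕ} (hi : i < m + 1) :
    star (expandingTuple x y m i) * expandingTuple x y m i = 1 := by
  rw [h.star_expandingTuple_mul hi hi, h.star_branch_mul_self, h.star_tuple_mul_self, mul_one,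
    mul_one, h.complete]

theorem star_expandingTuple_mul_ne {m i j : ℕ} (hi : i < m + 1) (hj : j < m + 1) (hij : i ≠ j) :
    star (expandingTuple x y m i) * expandingTuple x y m j = 0 := by
  rw [h.star_expandingTuple_mul hi hj, h.star_branch_mul_ne hij, h.star_tuple_mul_ne hi hj hij]
  simp

theorem expandingTuple_mul_star (m i : ℕ) :
    expandingTuple x y m i * star (expandingTuple x y m i) =
      x * (y ^ i * x * star (y ^ i * x)) * star x +
        (x * y ^ (m + 1) * star x + y * star y) * (tuple x y m i * star (tuple x y m i)) *
          star (x * y ^ (m + 1) * star x + y * star y) := by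
  unfold expandingTuple
  set c := x * y ^ (m + 1) * star x + y * star y
  set a := tuple x y m i
  set p := y ^ i * x
  calc (x * p * star x + c * a * star y) * star (x * p * star x + c * a * star y)
      = x * p * (star x * x) * star p * star x + x * p * (star x * y) * star a * star c
        + c * a * (star y * x) * star p * star x + c * a * (star y * y) * star a * star c := by
        simp only [star_add, star_mul, star_star]
        noncomm_ring
    _ = _ := by
        rw [h.star_left, h.star_right, h.orthogonal, h.orthogonal']
        noncomm_ring

/-- The first blocks fill the ranges of `x yⁱ x`; the second ones, by `sum_tuple`, fill the range of
the corner, which is exactly what is missing. -/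
theorem sum_expandingTuple (m : ℕ) :
    ∑ i ∈ Finset.range (m + 1), expandingTuple x y m i * star (expandingTuple x y m i) = 1 := by
  simp only [h.expandingTuple_mul_star, Finset.sum_add_distrib, ← Finset.mul_sum, ← Finset.sum_mul,
    h.sum_tuple, mul_one, h.corner_mul_star]
  rw [← add_assoc, ← add_mul, ← mul_add, h.sum_branch, mul_one, h.complete]

/-- Isometries with orthogonal ranges indexed by a countable type; they add up to `1` if the type
is finite and non-empty. -/
theorem exists_isometries (ι : Type*) [Countable ι] :
    ∃ s : ι → R, (∀ i, star (s i) * s i = 1) ∧ (∀ i j, i ≠ j → star (s i) * s j = 0) ∧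
      ∀ [Fintype ι], Nonempty ι → ∑ i, s i * star (s i) = 1 := by
  cases finite_or_infinite ι with
  | inl hfin =>
    obtain ⟨n, ⟨e⟩⟩ := Finite.exists_equiv_fin ι
    -- `tuple` with parameter `m` has `m + 1` members, hence `n - 1`; for `n = 0` there is no index
    -- to check.
    refine ⟨fun i => tuple x y (n - 1) (e i), fun i => h.star_tuple_mul_self _ _,
      fun i j hij => h.star_tuple_mul_ne (by omega) (by omega)
        (fun h => hij (e.injective (Fin.ext h))), fun {_} hne => ?_⟩
    obtain ⟨m, rfl⟩ : ∃ m, n = m + 1 := ⟨n - 1, by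
      have := (e hne.some).2
      omega⟩
    rw [e.sum_comp fun i : Fin (m + 1) => tuple x y (m + 1 - 1) i * star (tuple x y (m + 1 - 1) i)]
    rw [← h.sum_tuple m, Finset.sum_range]
    rfl
  | inr hinf =>
    obtain ⟨f, hf⟩ := exists_injective_nat ι
    exact ⟨fun i => y ^ f i * x, fun i => h.star_branch_mul_self _,
      fun i j hij => h.star_branch_mul_ne (hf.ne hij), fun {_} => (not_finite ι).elim⟩

/-- Isometries attached to the edges of a row-finite graph: those attached to the edges emitted by
a given vertex have orthogonal ranges which add up to `1`. -/
theorem exists_edge_isometries {V : Type v} {E : Type w} (G : DiGraph V E) (hG : G.RowFinite) :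
    ∃ (i : E → ℕ) (t : E → R), (∀ e f, e ≠ f → G.src e = G.src f → i e ≠ i f) ∧
      (∀ e, t e * x = x * (y ^ i e * x)) ∧ (∀ e, star (t e) * t e = 1) ∧
      (∀ e f, e ≠ f → G.src e = G.src f → star (t e) * t f = 0) ∧
      ∀ v (hfin : {e | G.src e = v}.Finite), {e | G.src e = v}.Nonempty →
        ∑ e ∈ hfin.toFinset, t e * star (t e) = 1 := by
  let S : V → Finset E := fun v => (hG v).toFinset
  have hS : ∀ e, e ∈ S (G.src e) := fun e => by simp [S]
  let idx : E → ℕ := fun e => (S (G.src e)).equivFin ⟨e, hS e⟩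
  -- The numbering lives on a type depending on the source. This lets edges whose sources are only
  -- propositionally equal be compared in one numbering.
  have hidx : ∀ v (e : S v), idx e = (S v).equivFin e := by
    rintro v ⟨e, he⟩
    obtain rfl : G.src e = v := by simpa [S] using he
    rfl
  have hlt : ∀ e, idx e < (S (G.src e)).card - 1 + 1 := fun e => by
    have := ((S (G.src e)).equivFin ⟨e, hS e⟩).2
    simp only [idx]
    omega
  have hne : ∀ e f, e ≠ f → G.src e = G.src f → idx e ≠ idx f := by
    intro e f hef hsrc hi
    have hf : f ∈ S (G.src e) := hsrc ▸ hS f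
    rw [hidx _ ⟨e, hS e⟩, hidx _ ⟨f, hf⟩] at hi
    exact hef (congrArg Subtype.val ((S (G.src e)).equivFin.injective (Fin.ext hi)))
  -- The source of an edge emits at least that edge, so the subtraction is not truncated and the
  -- tuple has as many members as there are emitted edges.
  refine ⟨idx, fun e => expandingTuple x y ((S (G.src e)).card - 1) (idx e), hne,
    fun e => h.expandingTuple_mul _ _, fun e => h.star_expandingTuple_mul_self (hlt e),
    fun e f hef hsrc => ?_, fun v hfin hv => ?_⟩
  · have := hlt f
    have h' := hne e f hef hsrc
    rw [← hsrc] at this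
    dsimp only
    rw [← hsrc]
    exact h.star_expandingTuple_mul_ne (hlt e) this h'
  · change ∑ e ∈ S v, _ = _
    have hcard : (S v).card - 1 + 1 = (S v).card := by
      have : 0 < (S v).card := Finset.card_pos.2 (by simpa [S] using hv)
      omega
    rw [← h.sum_expandingTuple ((S v).card - 1), hcard, Finset.sum_range, ← Finset.sum_coe_sort,
      ← (S v).equivFin.sum_comp]
    refine Finset.sum_congr rfl fun e _ => ?_
    have hsrc : G.src e = v := (hG v).mem_toFinset.1 e.2
    dsimp only
    rw [hsrc, hidx]

end IsCuntzPair

end Isometries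

/-! ### Cuntz–Krieger families and their twists -/

section CKFamily

variable {V : Type v} {E : Type w}

/-- A Cuntz–Krieger family for a graph in a `*`-ring. -/
structure IsCKFamily (G : DiGraph V E) {B : Type*} [Ring B] [StarRing B] (p : V → B) (d : E → B) :
    Prop where
  star_vert : ∀ v, star (p v) = p v
  vert_self : ∀ v, p v * p v = p v
  vert_ne : ∀ v w, v ≠ w → p v * p w = 0
  src_edge : ∀ e, p (G.src e) * d e = d e
  edge_rng : ∀ e, d e * p (G.rng e) = d e
  edge_self : ∀ e, star (d e) * d e = p (G.rng e)
  edge_ne : ∀ e f, e ≠ f → star (d e) * d f = 0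
  regular : ∀ v (hfin : {e | G.src e = v}.Finite), {e | G.src e = v}.Nonempty →
    ∑ e ∈ hfin.toFinset, d e * star (d e) = p v

namespace IsCKFamily

variable {G : DiGraph V E} {B : Type*} [Ring B] [StarRing B] {p : V → B} {d : E → B}

theorem map (h : IsCKFamily G p d) {B' : Type*} [Ring B'] [StarRing B'] (f : B →+* B')
    (hf : ∀ b, f (star b) = star (f b)) : IsCKFamily G (fun v => f (p v)) (fun e => f (d e)) where
  star_vert v := by rw [← hf, h.star_vert]
  vert_self v := by rw [← map_mul, h.vert_self]
  vert_ne v w hvw := by rw [← map_mul, h.vert_ne v w hvw, map_zero]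
  src_edge e := by rw [← map_mul, h.src_edge]
  edge_rng e := by rw [← map_mul, h.edge_rng]
  edge_self e := by rw [← hf, ← map_mul, h.edge_self]
  edge_ne e e' he := by rw [← hf, ← map_mul, h.edge_ne e e' he, map_zero]
  regular v hfin hne := by simp only [← hf, ← map_mul, ← map_sum, h.regular v hfin hne]

/-- Multiplying the edges by partial unitaries supported on the vertices gives another family. -/
theorem twist (h : IsCKFamily G p d) {U : V → B} (h1 : ∀ v, p v * U v = U v)
    (h2 : ∀ v, U v * p v = U v) (h3 : ∀ v, star (U v) * U v = p v)
    (h4 : ∀ v, U v * star (U v) = p v) : IsCKFamily G p (fun e => U (G.src e) * d e) where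
  star_vert := h.star_vert
  vert_self := h.vert_self
  vert_ne := h.vert_ne
  src_edge e := by rw [← mul_assoc, h1]
  edge_rng e := by rw [mul_assoc, h.edge_rng]
  edge_self e := by
    rw [star_mul, mul_assoc, ← mul_assoc (star (U _)), h3, h.src_edge, h.edge_self]
  edge_ne e f he := by
    rw [star_mul, mul_assoc, ← mul_assoc (star (U _))]
    by_cases hs : G.src e = G.src f
    · rw [← hs, h3, hs, h.src_edge, h.edge_ne e f he]
    · have : star (U (G.src e)) * U (G.src f) = 0 := by
        rw [← h1 (G.src e), ← h1 (G.src f), star_mul, h.star_vert, mul_assoc,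
          ← mul_assoc (p (G.src e)), h.vert_ne _ _ hs, zero_mul, mul_zero]
      rw [this, zero_mul, mul_zero]
  regular v hfin hne := by
    have hv : U v * p v * star (U v) = p v := by rw [h2, h4]
    rw [← hv, ← h.regular v hfin hne, Finset.mul_sum, Finset.sum_mul]
    refine Finset.sum_congr rfl fun e he => ?_
    have hs : G.src e = v := hfin.mem_toFinset.1 he
    rw [hs, star_mul]
    noncomm_ring

end IsCKFamily

end CKFamily

/-! ### Paths in the Leavitt path algebra -/

section Paths

variable {V : Type v} {E : Type w}

/-- The list of edges `l` is a path from `v` to `w`. -/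
def DiGraph.IsPath (G : DiGraph V E) : V → List E → V → Prop
  | v, [], w => v = w
  | v, e :: l, w => G.src e = v ∧ G.IsPath (G.rng e) l w

theorem DiGraph.IsPath.concat {G : DiGraph V E} {v : V} {l : List E} {e : E}
    (h : G.IsPath v l (G.src e)) : G.IsPath v (l ++ [e]) (G.rng e) := by
  induction l generalizing v with
  | nil => exact ⟨Eq.symm h, rfl⟩
  | cons f l ih => exact ⟨h.1, ih h.2⟩

namespace LeavittPath

variable (k : Type u) [CommRing k] (G : DiGraph V E) [StarRing k]

theorem vert_mul_self (v : V) : gen k G (.vert v) * gen k G (.vert v) = gen k G (.vert v) :=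
  Subtype.ext <| by
    simpa [PathUnital.gen] using! RingQuot.mkAlgHom_rel k (PathRel.vert_self (k := k) (G := G) v)

theorem vert_mul_ne {v w : V} (h : v ≠ w) : gen k G (.vert v) * gen k G (.vert w) = 0 :=
  Subtype.ext <| by
    simpa [PathUnital.gen] using! RingQuot.mkAlgHom_rel k (PathRel.vert_ne (k := k) (G := G) v w h)

theorem src_mul_edge (e : E) :
    gen k G (.vert (G.src e)) * gen k G (.edge e) = gen k G (.edge e) :=
  Subtype.ext <| by
    simpa [PathUnital.gen] using! RingQuot.mkAlgHom_rel k (PathRel.src_edge (k := k) (G := G) e)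

theorem edge_mul_rng (e : E) :
    gen k G (.edge e) * gen k G (.vert (G.rng e)) = gen k G (.edge e) :=
  Subtype.ext <| by
    simpa [PathUnital.gen] using! RingQuot.mkAlgHom_rel k (PathRel.edge_rng (k := k) (G := G) e)

theorem ghost_mul_src (e : E) :
    gen k G (.ghost e) * gen k G (.vert (G.src e)) = gen k G (.ghost e) :=
  Subtype.ext <| by
    simpa [PathUnital.gen] using! RingQuot.mkAlgHom_rel k (PathRel.ghost_src (k := k) (G := G) e)

theorem ghost_mul_edge_self (e : E) :
    gen k G (.ghost e) * gen k G (.edge e) = gen k G (.vert (G.rng e)) :=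
  Subtype.ext <| by
    simpa [PathUnital.gen] using!
      RingQuot.mkAlgHom_rel k (PathRel.ghost_edge_self (k := k) (G := G) e)

theorem ghost_mul_edge_ne {e f : E} (h : e ≠ f) :
    gen k G (.ghost e) * gen k G (.edge f) = 0 :=
  Subtype.ext <| by
    simpa [PathUnital.gen] using!
      RingQuot.mkAlgHom_rel k (PathRel.ghost_edge_ne (k := k) (G := G) e f h)

theorem sum_edge_mul_ghost (v : V) (hfin : {e | G.src e = v}.Finite)
    (hne : {e | G.src e = v}.Nonempty) :
    ∑ e ∈ hfin.toFinset, gen k G (.edge e) * gen k G (.ghost e) = gen k G (.vert v) :=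
  Subtype.ext <| by
    simpa [PathUnital.gen, gen] using!
      RingQuot.mkAlgHom_rel k (PathRel.regular (k := k) (G := G) v hfin hne)

variable {k G}

theorem edge_mul_vert_ne {e : E} {v : V} (h : G.rng e ≠ v) :
    gen k G (.edge e) * gen k G (.vert v) = 0 := by
  rw [← edge_mul_rng, mul_assoc, vert_mul_ne k G h, mul_zero]

theorem ghost_mul_vert_ne {e : E} {v : V} (h : G.src e ≠ v) :
    gen k G (.ghost e) * gen k G (.vert v) = 0 := by
  rw [← ghost_mul_src, mul_assoc, vert_mul_ne k G h, mul_zero]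

theorem vert_mul_edge_ne {e : E} {v : V} (h : v ≠ G.src e) :
    gen k G (.vert v) * gen k G (.edge e) = 0 := by
  rw [← src_mul_edge, ← mul_assoc, vert_mul_ne k G h, zero_mul]

-- The generators are closed under `star`, so the star subalgebra they generate is already the
-- non-unital subalgebra, and no case for `star` is needed.
@[elab_as_elim]
theorem induction {P : LeavittPath k G → Prop} (hgen : ∀ g, P (gen k G g)) (hzero : P 0)
    (hadd : ∀ a b, P a → P b → P (a + b)) (hmul : ∀ a b, P a → P b → P (a * b))
    (hsmul : ∀ (c : k) a, P a → P (c • a)) (a : LeavittPath k G) : P a := by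
  have hset : (Set.range (PathUnital.gen k G)) ∪ star (Set.range (PathUnital.gen k G)) =
      Set.range (PathUnital.gen k G) := by
    refine Set.union_eq_self_of_subset_right ?_
    rintro x ⟨g, hg⟩
    exact ⟨g.flip, by rw [← PathUnital.star_gen, hg, star_star]⟩
  have hiff : ∀ x : PathUnital k G,
      x ∈ NonUnitalStarAlgebra.adjoin k (Set.range (PathUnital.gen k G)) ↔
      x ∈ NonUnitalAlgebra.adjoin k (Set.range (PathUnital.gen k G)) := by
    intro x
    rw [← NonUnitalStarSubalgebra.mem_toNonUnitalSubalgebra,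
      NonUnitalStarAlgebra.adjoin_toNonUnitalSubalgebra, hset]
  obtain ⟨x, hx⟩ := a
  have hx' := (hiff x).1 hx
  revert hx
  induction hx' using NonUnitalAlgebra.adjoin_induction with
  | mem x hx => obtain ⟨g, rfl⟩ := hx; exact fun _ => hgen g
  | zero => exact fun _ => hzero
  | add x y hx hy ihx ihy =>
    exact fun _ => hadd ⟨x, (hiff x).2 hx⟩ ⟨y, (hiff y).2 hy⟩ (ihx _) (ihy _)
  | mul x y hx hy ihx ihy =>
    exact fun _ => hmul ⟨x, (hiff x).2 hx⟩ ⟨y, (hiff y).2 hy⟩ (ihx _) (ihy _)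
  | smul c x hx ih => exact fun _ => hsmul c ⟨x, (hiff x).2 hx⟩ (ih _)

/-- Ghost edges go to the adjoints of the edges, and their relations to vertices are adjoints of
those for edges. Compatibility with `star` then only has to be checked on generators. -/
theorem exists_starLift {B : Type*} [Ring B] [StarRing B] [Algebra k B] [StarModule k B]
    {p : V → B} {d : E → B} (h : IsCKFamily G p d) :
    ∃ F : LeavittPath k G →⋆ₙₐ[k] B, (∀ v, F (gen k G (.vert v)) = p v) ∧
      ∀ e, F (gen k G (.edge e)) = d e := by
  let f : PathGen V E → B
    | .vert v => p v
    | .edge e => d e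
    | .ghost e => star (d e)
  have hf : ∀ g, f g.flip = star (f g) := by
    rintro (v | e | e) <;> simp [f, PathGen.flip, h.star_vert]
  obtain ⟨F, hF, -⟩ := existsUnique_lift k G f h.vert_self h.vert_ne h.src_edge h.edge_rng
    (fun e => by simpa [f, h.star_vert] using congrArg star (h.edge_rng e))
    (fun e => by simpa [f, h.star_vert] using congrArg star (h.src_edge e))
    h.edge_self h.edge_ne h.regular
  have hstar : ∀ a, F (star a) = star (F a) := by
    intro a
    induction a using induction with
    | hgen g => rw [star_gen, hF, hF, hf]
    | hzero => simp
    | hadd a b ha hb => rw [star_add, map_add, map_add, star_add, ha, hb]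
    | hmul a b ha hb => rw [star_mul, map_mul, map_mul, star_mul, ha, hb]
    | hsmul c a ha => rw [star_smul, map_smul, map_smul, star_smul, ha]
  exact ⟨{ F with map_star' := hstar }, fun v => hF (.vert v), fun e => hF (.edge e)⟩

variable (k G)

/-- The element of the Leavitt path algebra given by a path starting at a vertex. -/
noncomputable def ofPath : V → List E → LeavittPath k G
  | v, [] => gen k G (.vert v)
  | _, e :: l => gen k G (.edge e) * ofPath (G.rng e) l

variable {k G}

theorem vert_mul_ofPath {v w : V} {l : List E} (h : G.IsPath v l w) :
    gen k G (.vert v) * ofPath k G v l = ofPath k G v l := by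
  cases l with
  | nil => exact vert_mul_self k G v
  | cons e l =>
    obtain ⟨rfl, -⟩ := h
    rw [ofPath, ← mul_assoc, src_mul_edge]

theorem ofPath_mul_vert {v w : V} {l : List E} (h : G.IsPath v l w) :
    ofPath k G v l * gen k G (.vert w) = ofPath k G v l := by
  induction l generalizing v with
  | nil => obtain rfl := h; exact vert_mul_self k G v
  | cons e l ih => rw [ofPath, mul_assoc, ih h.2]

theorem ofPath_mul_edge {v : V} {l : List E} {e : E} (h : G.IsPath v l (G.src e)) :
    ofPath k G v l * gen k G (.edge e) = ofPath k G v (l ++ [e]) := by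
  induction l generalizing v with
  | nil =>
    obtain rfl := h
    simp only [ofPath, List.nil_append, src_mul_edge, edge_mul_rng]
  | cons f l ih => rw [ofPath, mul_assoc, ih h.2, List.cons_append, ofPath]

theorem star_ofPath_mul_self {v w : V} {l : List E} (h : G.IsPath v l w) :
    star (ofPath k G v l) * ofPath k G v l = gen k G (.vert w) := by
  induction l generalizing v with
  | nil =>
    obtain rfl := h
    rw [ofPath, star_gen]
    exact vert_mul_self k G v
  | cons e l ih =>
    rw [ofPath, star_mul, star_gen, mul_assoc, PathGen.flip, ← mul_assoc (gen k G (.ghost e)),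
      ghost_mul_edge_self, vert_mul_ofPath h.2, ih h.2]

/-- Cancelling common first edges leads to `e* f` with `e ≠ f`, or to two distinct vertices if the
paths are empty; equal lengths exclude a proper prefix. -/
theorem star_ofPath_mul_ne {v w v' w' : V} {l l' : List E} (h : G.IsPath v l w)
    (h' : G.IsPath v' l' w') (hlen : l.length = l'.length) (hne : v = v' → l ≠ l') :
    star (ofPath k G v l) * ofPath k G v' l' = 0 := by
  induction l generalizing v v' l' with
  | nil =>
    obtain rfl := List.eq_nil_of_length_eq_zero hlen.symm
    rw [ofPath, star_gen]
    exact vert_mul_ne k G fun hv => hne hv rfl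
  | cons e l ih =>
    cases l' with
    | nil => simp at hlen
    | cons e' l' =>
      rw [ofPath, ofPath, star_mul, star_gen, mul_assoc, PathGen.flip,
        ← mul_assoc (gen k G (.ghost e))]
      by_cases he : e = e'
      · subst he
        rw [ghost_mul_edge_self, vert_mul_ofPath h'.2]
        refine ih h.2 h'.2 (by simpa using hlen) fun _ hl => hne (h.1.symm.trans h'.1) ?_
        rw [hl]
      · rw [ghost_mul_edge_ne k G he, zero_mul, mul_zero]

/-! ### The filtration by ghost edges and the injectivity criterion -/

variable (k G)

/-- The span of the paths. -/
noncomputable def pathSpan : Submodule k (LeavittPath k G) :=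
  Submodule.span k (Set.range fun p : {p : V × List E // ∃ w, G.IsPath p.1 p.2 w} =>
    ofPath k G p.1.1 p.1.2)

/-- The span of the products of a path and at most `n` ghost edges. -/
noncomputable def ghostSpan : ℕ → Submodule k (LeavittPath k G)
  | 0 => pathSpan k G
  | n + 1 => pathSpan k G ⊔
      Submodule.span k {a | ∃ b ∈ ghostSpan n, ∃ e, a = b * gen k G (.ghost e)}

variable {k G}

theorem ofPath_mem_pathSpan {v w : V} {l : List E} (h : G.IsPath v l w) :
    ofPath k G v l ∈ pathSpan k G :=
  Submodule.subset_span ⟨⟨(v, l), w, h⟩, rfl⟩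

theorem pathSpan_le_ghostSpan (n : ℕ) : pathSpan k G ≤ ghostSpan k G n := by
  cases n with
  | zero => exact le_rfl
  | succ n => exact le_sup_left

theorem ghostSpan_mono : Monotone (ghostSpan k G) := by
  refine monotone_nat_of_le_succ fun n => ?_
  induction n with
  | zero => exact le_sup_left
  | succ n ih =>
    refine sup_le_sup_left (Submodule.span_mono ?_) _
    rintro _ ⟨b, hb, e, rfl⟩
    exact ⟨b, ih hb, e, rfl⟩

theorem mul_ghost_mem {n : ℕ} {a : LeavittPath k G} (ha : a ∈ ghostSpan k G n) (e : E) :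
    a * gen k G (.ghost e) ∈ ghostSpan k G (n + 1) :=
  Submodule.mem_sup_right (Submodule.subset_span ⟨a, ha, e, rfl⟩)

/-- Right multiplication by `c` maps `pathSpan ⊔ span {b e*}` into `S` if it does so on
generators. -/
theorem mul_mem_of_mem_ghostSpan_succ {n : ℕ} {S : Submodule k (LeavittPath k G)}
    {c : LeavittPath k G} (h1 : ∀ a ∈ pathSpan k G, a * c ∈ S)
    (h2 : ∀ b ∈ ghostSpan k G n, ∀ e, b * gen k G (.ghost e) * c ∈ S)
    {a : LeavittPath k G} (ha : a ∈ ghostSpan k G (n + 1)) : a * c ∈ S := by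
  have : ghostSpan k G (n + 1) ≤ S.comap (LinearMap.mulRight k c) := by
    refine sup_le h1 (Submodule.span_le.2 ?_)
    rintro _ ⟨b, hb, e, rfl⟩
    exact h2 b hb e
  exact this ha

theorem mul_vert_mem_pathSpan {a : LeavittPath k G} (ha : a ∈ pathSpan k G) (v : V) :
    a * gen k G (.vert v) ∈ pathSpan k G := by
  have : pathSpan k G ≤ (pathSpan k G).comap (LinearMap.mulRight k (gen k G (.vert v))) := by
    refine Submodule.span_le.2 ?_
    rintro _ ⟨⟨⟨v', l⟩, w, h⟩, rfl⟩
    change ofPath k G v' l * gen k G (.vert v) ∈ pathSpan k G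
    by_cases hw : w = v
    · subst hw
      rw [ofPath_mul_vert h]
      exact ofPath_mem_pathSpan h
    · rw [← ofPath_mul_vert h, mul_assoc, vert_mul_ne k G hw, mul_zero]
      exact zero_mem _
  exact this ha

theorem mul_edge_mem_pathSpan {a : LeavittPath k G} (ha : a ∈ pathSpan k G) (e : E) :
    a * gen k G (.edge e) ∈ pathSpan k G := by
  have : pathSpan k G ≤ (pathSpan k G).comap (LinearMap.mulRight k (gen k G (.edge e))) := by
    refine Submodule.span_le.2 ?_
    rintro _ ⟨⟨⟨v', l⟩, w, h⟩, rfl⟩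
    change ofPath k G v' l * gen k G (.edge e) ∈ pathSpan k G
    by_cases hw : w = G.src e
    · subst hw
      rw [ofPath_mul_edge h]
      exact ofPath_mem_pathSpan h.concat
    · rw [← ofPath_mul_vert h, mul_assoc, vert_mul_edge_ne hw, mul_zero]
      exact zero_mem _
  exact this ha

theorem mul_vert_mem {n : ℕ} {a : LeavittPath k G} (ha : a ∈ ghostSpan k G n) (v : V) :
    a * gen k G (.vert v) ∈ ghostSpan k G n := by
  cases n with
  | zero => exact mul_vert_mem_pathSpan ha v
  | succ n =>
    refine mul_mem_of_mem_ghostSpan_succ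
      (fun a ha => pathSpan_le_ghostSpan _ (mul_vert_mem_pathSpan ha v)) (fun b hb e => ?_) ha
    rw [mul_assoc]
    by_cases he : G.src e = v
    · subst he
      rw [ghost_mul_src]
      exact mul_ghost_mem hb e
    · rw [ghost_mul_vert_ne he, mul_zero]
      exact zero_mem _

/-- The last ghost edge cancels against `e` to a vertex or gives zero. This drop drives the
induction in `injective_of_linearIndependent`. -/
theorem mul_edge_mem_of_succ {n : ℕ} {a : LeavittPath k G} (ha : a ∈ ghostSpan k G (n + 1))
    (e : E) : a * gen k G (.edge e) ∈ ghostSpan k G n := by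
  refine mul_mem_of_mem_ghostSpan_succ
    (fun a ha => pathSpan_le_ghostSpan _ (mul_edge_mem_pathSpan ha e)) (fun b hb f => ?_) ha
  rw [mul_assoc]
  by_cases he : f = e
  · subst he
    rw [ghost_mul_edge_self]
    exact mul_vert_mem hb _
  · rw [ghost_mul_edge_ne k G he, mul_zero]
    exact zero_mem _

/-- Since `f* = f* s(f)` and a sink is no source, every word ending in a ghost edge is killed. -/
theorem mul_sink_mem {n : ℕ} {a : LeavittPath k G} (ha : a ∈ ghostSpan k G n) {v : V}
    (hv : ∀ e, G.src e ≠ v) : a * gen k G (.vert v) ∈ pathSpan k G := by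
  cases n with
  | zero => exact mul_vert_mem_pathSpan ha v
  | succ n =>
    refine mul_mem_of_mem_ghostSpan_succ (fun a ha => mul_vert_mem_pathSpan ha v)
      (fun b hb e => ?_) ha
    rw [mul_assoc, ghost_mul_vert_ne (hv e), mul_zero]
    exact zero_mem _

theorem exists_mem_ghostSpan (a : LeavittPath k G) : ∃ n, a ∈ ghostSpan k G n := by
  -- Strengthened so that the induction passes through products: right multiplication by `a` must
  -- preserve the union of the filtration.
  suffices (∃ n, a ∈ ghostSpan k G n) ∧
      ∀ b, (∃ n, b ∈ ghostSpan k G n) → ∃ n, b * a ∈ ghostSpan k G n from this.1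
  have hvert : ∀ v, gen k G (.vert v) ∈ ghostSpan k G 0 := fun v =>
    ofPath_mem_pathSpan (l := []) (v := v) rfl
  induction a using induction with
  | hgen g =>
    cases g with
    | vert v => exact ⟨⟨0, hvert v⟩, fun b ⟨n, hb⟩ => ⟨n, mul_vert_mem hb v⟩⟩
    | edge e =>
      refine ⟨⟨0, ?_⟩, fun b ⟨n, hb⟩ =>
        ⟨n, mul_edge_mem_of_succ (ghostSpan_mono n.le_succ hb) e⟩⟩
      rw [← src_mul_edge]
      exact mul_edge_mem_pathSpan (hvert _) e
    | ghost e =>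
      refine ⟨⟨1, ?_⟩, fun b ⟨n, hb⟩ => ⟨n + 1, mul_ghost_mem hb e⟩⟩
      have := mul_ghost_mem (hvert (G.rng e)) e
      have h := congrArg star (edge_mul_rng k G e)
      rw [star_mul, star_gen, star_gen] at h
      exact (congrArg (· ∈ ghostSpan k G 1) h).mp this
  | hzero => exact ⟨⟨0, zero_mem _⟩, fun b _ => ⟨0, by rw [mul_zero]; exact zero_mem _⟩⟩
  | hadd a a' ha ha' =>
    have key : ∀ x y : LeavittPath k G, (∃ n, x ∈ ghostSpan k G n) → (∃ n, y ∈ ghostSpan k G n) →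
        ∃ n, x + y ∈ ghostSpan k G n := fun x y ⟨m, hx⟩ ⟨n, hy⟩ =>
      ⟨max m n, add_mem (ghostSpan_mono (le_max_left _ _) hx)
        (ghostSpan_mono (le_max_right _ _) hy)⟩
    refine ⟨key _ _ ha.1 ha'.1, fun b hb => ?_⟩
    rw [mul_add]
    exact key _ _ (ha.2 b hb) (ha'.2 b hb)
  | hmul a a' ha ha' =>
    refine ⟨ha'.2 a ha.1, fun b hb => ?_⟩
    rw [← mul_assoc]
    exact ha'.2 _ (ha.2 b hb)
  | hsmul c a ha =>
    refine ⟨ha.1.imp fun n h => Submodule.smul_mem _ c h, fun b hb => ?_⟩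
    rw [mul_smul_comm]
    exact (ha.2 b hb).imp fun n h => Submodule.smul_mem _ c h

/-- A replacement for the unit when `V` is infinite. Allowing all larger finite sets lets the sets
found for two summands be merged. -/
theorem exists_local_unit (a : LeavittPath k G) :
    ∃ s : Finset V, ∀ s', s ⊆ s' → ∑ v ∈ s', a * gen k G (.vert v) = a := by
  classical
  induction a using induction with
  | hgen g =>
    obtain ⟨w, hw, hne⟩ : ∃ w, gen k G g * gen k G (.vert w) = gen k G g ∧
        ∀ v, w ≠ v → gen k G g * gen k G (.vert v) = 0 := by
      cases g with
      | vert v => exact ⟨v, vert_mul_self k G v, fun w h => vert_mul_ne k G h⟩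
      | edge e => exact ⟨G.rng e, edge_mul_rng k G e, fun w h => edge_mul_vert_ne h⟩
      | ghost e => exact ⟨G.src e, ghost_mul_src k G e, fun w h => ghost_mul_vert_ne h⟩
    refine ⟨{w}, fun s' hs => ?_⟩
    rw [Finset.sum_eq_single w (fun v _ hv => hne v hv.symm)
      (fun h => (h (hs (Finset.mem_singleton_self w))).elim), hw]
  | hzero => exact ⟨∅, fun s' _ => by simp⟩
  | hadd a b ha hb =>
    obtain ⟨s, hs⟩ := ha
    obtain ⟨t, ht⟩ := hb
    refine ⟨s ∪ t, fun s' h => ?_⟩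
    simp only [add_mul, Finset.sum_add_distrib]
    rw [hs s' (Finset.union_subset_left h), ht s' (Finset.union_subset_right h)]
  | hmul a b _ hb =>
    obtain ⟨t, ht⟩ := hb
    refine ⟨t, fun s' h => ?_⟩
    simp only [mul_assoc]
    rw [← Finset.mul_sum, ht s' h]
  | hsmul c a ha =>
    obtain ⟨s, hs⟩ := ha
    refine ⟨s, fun s' h => ?_⟩
    simp only [smul_mul_assoc, ← Finset.smul_sum]
    rw [hs s' h]

theorem eq_zero_of_mul_vert {a : LeavittPath k G} (h : ∀ v, a * gen k G (.vert v) = 0) :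
    a = 0 := by
  obtain ⟨s, hs⟩ := exists_local_unit a
  rw [← hs s subset_rfl]
  exact Finset.sum_eq_zero fun v _ => h v

/-- A homomorphism out of the Leavitt path algebra of a row-finite graph is injective as soon as
the images of the paths are linearly independent. -/
theorem injective_of_linearIndependent (hG : G.RowFinite) {B : Type*} [NonUnitalRing B]
    [Module k B] (F : LeavittPath k G →ₙₐ[k] B)
    (hF : LinearIndependent k fun p : {p : V × List E // ∃ w, G.IsPath p.1 p.2 w} =>
      F (ofPath k G p.1.1 p.1.2)) : Function.Injective F := by
  have hbase : ∀ a ∈ pathSpan k G, F a = 0 → a = 0 := by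
    intro a ha h0
    obtain ⟨c, rfl⟩ := Finsupp.mem_span_range_iff_exists_finsupp.1 ha
    have hc : c = 0 := by
      refine linearIndependent_iff.1 hF c ?_
      rw [Finsupp.linearCombination_apply, ← h0, Finsupp.sum, Finsupp.sum, map_sum]
      exact Finset.sum_congr rfl fun p _ => (map_smul F _ _).symm
    rw [hc, Finsupp.sum_zero_index]
  have hstep : ∀ n, ∀ a ∈ ghostSpan k G n, F a = 0 → a = 0 := by
    intro n
    induction n with
    | zero => exact hbase
    | succ n ih =>
      intro a ha h0
      refine eq_zero_of_mul_vert fun v => ?_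
      -- By row-finiteness a vertex is regular or a sink. In the first case `a v = ∑ (a e) e*`,
      -- where each `a e` is in the kernel and lower in the filtration.
      by_cases hv : {e | G.src e = v}.Nonempty
      · rw [← sum_edge_mul_ghost k G v (hG v) hv, Finset.mul_sum]
        refine Finset.sum_eq_zero fun e _ => ?_
        rw [← mul_assoc, ih _ (mul_edge_mem_of_succ ha e) (by rw [map_mul, h0, zero_mul]),
          zero_mul]
      · refine hbase _ (mul_sink_mem ha fun e he => hv ⟨e, he⟩) ?_
        rw [map_mul, h0, zero_mul]
  refine (injective_iff_map_eq_zero F).2 fun a h0 => ?_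
  obtain ⟨n, hn⟩ := exists_mem_ghostSpan a
  exact hstep n a hn h0

end LeavittPath

end Paths

/-- Applying `f i` to a linear relation isolates its `i`-th coefficient. The maps take values in a
vector space, as they will be compressions followed by a degree-zero projection. -/
theorem linearIndependent_of_separating {k : Type*} [Field k] {M N ι : Type*} [AddCommGroup M]
    [Module k M] [AddCommGroup N] [Module k N] {x : ι → M} (f : ι → M →ₗ[k] N)
    (h1 : ∀ i, f i (x i) ≠ 0) (h2 : ∀ i j, i ≠ j → f i (x j) = 0) : LinearIndependent k x := by
  refine linearIndependent_iff'.2 fun s g hg i hi => ?_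
  have h := congrArg (f i) hg
  rw [map_sum, map_zero, Finset.sum_eq_single i
    (fun j _ hj => by rw [map_smul, h2 i j hj.symm, smul_zero]) (fun h => (h hi).elim),
    map_smul] at h
  exact (smul_eq_zero.1 h).resolve_right (h1 i)

/-! ### Injectivity of the homomorphisms to `L(1,2)` and to the tensor square -/

section Embedding

variable {k : Type u} [Field k] [StarRing k] {V : Type v} {E : Type w} {G : DiGraph V E}

theorem Leavitt.isCuntzPair : IsCuntzPair (gen k (.x 0)) (gen k (.x 1)) where
  star_left := by rw [star_gen]; exact xs_mul_x_self k 0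
  star_right := by rw [star_gen]; exact xs_mul_x_self k 1
  orthogonal := by rw [star_gen]; exact xs_mul_x_ne k (by decide)
  complete := by rw [star_gen, star_gen]; exact x_mul_xs_add k

/-- The product of the words `x₁ⁱ x₀` along a list of edges. -/
noncomputable def Leavitt.word (k : Type u) [Field k] {E : Type w} (i : E → ℕ) (l : List E) :
    Leavitt k :=
  (l.map fun e => gen k (.x 1) ^ i e * gen k (.x 0)).prod

omit [StarRing k] in
theorem Leavitt.word_mem_component (i : E → ℕ) (l : List E) :
    ∃ n : ℕ, word k i l ∈ component k n ∧ (l ≠ [] → 0 < n) := by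
  induction l with
  | nil => exact ⟨0, one_mem_component k, fun h => (h rfl).elim⟩
  | cons e l ih =>
    obtain ⟨n, hn, -⟩ := ih
    have hpow : ∀ j : ℕ, gen k (.x 1) ^ j ∈ component k j := fun j => by
      induction j with
      | zero => simpa using one_mem_component k
      | succ j ih =>
        rw [pow_succ, Nat.cast_succ]
        exact mul_mem_component k ih (gen_mem_component k (.x 1))
    refine ⟨i e + 1 + n, ?_, fun _ => by omega⟩
    push_cast
    exact mul_mem_component k
      (mul_mem_component k (hpow (i e)) (gen_mem_component k (.x 0))) hn

theorem Leavitt.star_word_mul_self (i : E → ℕ) (l : List E) :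
    star (word k i l) * word k i l = 1 := by
  induction l with
  | nil => simp [word]
  | cons e l ih =>
    simp only [word, List.map_cons, List.prod_cons] at ih ⊢
    rw [star_mul, mul_assoc, ← mul_assoc (star (_ ^ _ * _)), isCuntzPair.star_branch_mul_self,
      one_mul, ih]

/-- After cancelling the common prefix, either two edges with the same source differ, and their
letters are orthogonal, or one word is a prefix of the other and a nonempty word, of positive
degree, or its adjoint remains. -/
theorem Leavitt.star_word_mul_word {i : E → ℕ}
    (hi : ∀ e f, e ≠ f → G.src e = G.src f → i e ≠ i f) {v w w' : V} {l l' : List E}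
    (h : G.IsPath v l w) (h' : G.IsPath v l' w') (hne : l ≠ l') :
    ∃ n : ℤ, n ≠ 0 ∧ star (word k i l) * word k i l' ∈ component k n := by
  induction l generalizing v l' with
  | nil =>
    obtain ⟨n, hn, hpos⟩ := word_mem_component (k := k) i l'
    have := hpos hne.symm
    exact ⟨n, by omega, by simpa [word] using hn⟩
  | cons e l ih =>
    cases l' with
    | nil =>
      obtain ⟨n, hn, hpos⟩ := word_mem_component (k := k) i (e :: l)
      have := hpos hne
      refine ⟨-n, by omega, ?_⟩
      simpa [word] using star_mem_component hn
    | cons e' l' =>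
      have hmul : star (word k i (e :: l)) * word k i (e' :: l') =
          star (word k i l) * (star (gen k (.x 1) ^ i e * gen k (.x 0)) *
            (gen k (.x 1) ^ i e' * gen k (.x 0)) * word k i l') := by
        simp only [word, List.map_cons, List.prod_cons, star_mul, mul_assoc]
      rw [hmul]
      by_cases he : e = e'
      · subst he
        rw [isCuntzPair.star_branch_mul_self, one_mul]
        exact ih h.2 h'.2 fun hl => hne (by rw [hl])
      · rw [isCuntzPair.star_branch_mul_ne (hi e e' he (h.1.trans h'.1.symm)), zero_mul, mul_zero]
        -- The product is zero, hence homogeneous of any degree; `1` is arbitrary.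
        exact ⟨1, one_ne_zero, zero_mem _⟩

/-- Isometries at the vertices and at the edges give a Cuntz–Krieger family. -/
theorem isCKFamily_of_isometries {B : Type*} [Ring B] [StarRing B] {s : V → B} {t : E → B}
    (hs : ∀ v, star (s v) * s v = 1) (hs' : ∀ v w, v ≠ w → star (s v) * s w = 0)
    (ht : ∀ e, star (t e) * t e = 1)
    (ht' : ∀ e f, e ≠ f → G.src e = G.src f → star (t e) * t f = 0)
    (hsum : ∀ v (hfin : {e | G.src e = v}.Finite), {e | G.src e = v}.Nonempty →
        ∑ e ∈ hfin.toFinset, t e * star (t e) = 1) :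
    IsCKFamily G (fun v => s v * star (s v))
      (fun e => s (G.src e) * t e * star (s (G.rng e))) := by
  have hs1 : ∀ v c, star (s v) * (s v * c) = c := fun v c => by rw [← mul_assoc, hs, one_mul]
  have ht1 : ∀ e c, star (t e) * (t e * c) = c := fun e c => by rw [← mul_assoc, ht, one_mul]
  refine ⟨fun v => by simp, fun v => ?_, fun v w h => ?_, fun e => ?_, fun e => ?_, fun e => ?_,
    fun e f h => ?_, fun v hfin hne => ?_⟩
  · simp only [mul_assoc, hs1]
  · rw [mul_assoc, ← mul_assoc (star (s v)), hs' v w h, zero_mul, mul_zero]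
  · simp only [mul_assoc, hs1]
  · simp only [mul_assoc, hs1]
  · simp only [star_mul, star_star, mul_assoc, hs1, ht1]
  · by_cases hsrc : G.src e = G.src f
    · simp only [star_mul, star_star, mul_assoc]
      rw [← hsrc, hs1, ← mul_assoc (star (t e)), ht' e f h hsrc, zero_mul, mul_zero]
    · simp only [star_mul, star_star, mul_assoc]
      rw [← mul_assoc (star (s (G.src e))), hs' _ _ hsrc, zero_mul, mul_zero, mul_zero]
  · have h1 : s v * star (s v) = s v * 1 * star (s v) := by rw [mul_one]
    rw [h1, ← hsum v hfin hne, Finset.mul_sum, Finset.sum_mul]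
    refine Finset.sum_congr rfl fun e he => ?_
    have hsrc : G.src e = v := hfin.mem_toFinset.1 he
    simp only [star_mul, star_star, mul_assoc, hs1, hsrc]

/-- The homomorphism to `L_k(1,2)` attached to isometries at the vertices and at the edges is
injective if the edges compress to distinct words `x₁ⁱ x₀`. -/
theorem injective_of_compression (hG : G.RowFinite) {s : V → Leavitt k} {t : E → Leavitt k}
    {i : E → ℕ} (hs : ∀ v, star (s v) * s v = 1) (hs' : ∀ v w, v ≠ w → star (s v) * s w = 0)
    (hi : ∀ e f, e ≠ f → G.src e = G.src f → i e ≠ i f)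
    (ht : ∀ e, t e * Leavitt.gen k (.x 0) =
      Leavitt.gen k (.x 0) * (Leavitt.gen k (.x 1) ^ i e * Leavitt.gen k (.x 0)))
    (F : LeavittPath k G →⋆ₙₐ[k] Leavitt k)
    (hFv : ∀ v, F (LeavittPath.gen k G (.vert v)) = s v * star (s v))
    (hFe : ∀ e, F (LeavittPath.gen k G (.edge e)) = s (G.src e) * t e * star (s (G.rng e))) :
    Function.Injective F := by
  have := Leavitt.nontrivial k
  obtain ⟨π, hπ0, hπ1⟩ := Leavitt.exists_proj k
  have hpath : ∀ {v l w}, G.IsPath v l w →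
      F (LeavittPath.ofPath k G v l) = s v * (l.map t).prod * star (s w) := by
    intro v l w h
    induction l generalizing v with
    | nil =>
      obtain rfl := h
      simp [LeavittPath.ofPath, hFv]
    | cons e l ih =>
      rw [LeavittPath.ofPath, map_mul, hFe, ih h.2, h.1, List.map_cons, List.prod_cons]
      calc s v * t e * star (s (G.rng e)) * (s (G.rng e) * (l.map t).prod * star (s w))
          = s v * t e * (star (s (G.rng e)) * s (G.rng e)) * (l.map t).prod * star (s w) := by
            noncomm_ring
        _ = _ := by rw [hs]; noncomm_ring
  have hword : ∀ l : List E, (l.map t).prod * Leavitt.gen k (.x 0) =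
      Leavitt.gen k (.x 0) * Leavitt.word k i l := by
    intro l
    induction l with
    | nil => simp [Leavitt.word]
    | cons e l ih =>
      rw [List.map_cons, List.prod_cons, mul_assoc, ih, ← mul_assoc, ht]
      simp [Leavitt.word, mul_assoc]
  choose r hr using fun p : {p : V × List E // ∃ w, G.IsPath p.1 p.2 w} => p.2
  -- The isometries of the source and the chosen endpoint strip the ends off the image of a path,
  -- `x` turns its middle into a word, and the adjoint of the word of `p` tests for `p` itself.
  -- Other endpoints give zero by orthogonality.
  let f : {p : V × List E // ∃ w, G.IsPath p.1 p.2 w} → Leavitt k →ₗ[k] Leavitt k := fun p =>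
    π ∘ₗ LinearMap.mulLeft k
      (star (Leavitt.word k i p.1.2) * star (Leavitt.gen k (.x 0)) * star (s p.1.1)) ∘ₗ
      LinearMap.mulRight k (s (r p) * Leavitt.gen k (.x 0))
  have hf : ∀ p q, f p (F (LeavittPath.ofPath k G q.1.1 q.1.2)) =
      π (star (Leavitt.word k i p.1.2) * star (Leavitt.gen k (.x 0)) *
        (star (s p.1.1) * s q.1.1) * (q.1.2.map t).prod *
        (star (s (r q)) * s (r p)) * Leavitt.gen k (.x 0)) := by
    intro p q
    rw [hpath (hr q)]
    simp [f, mul_assoc]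
  have hf1 : ∀ p q, p.1.1 = q.1.1 → r p = r q →
      f p (F (LeavittPath.ofPath k G q.1.1 q.1.2)) =
        π (star (Leavitt.word k i p.1.2) * Leavitt.word k i q.1.2) := by
    intro p q h1 h2
    rw [hf, h1, h2, hs, hs, mul_one, mul_one, mul_assoc _ (List.prod _), hword, mul_assoc,
      Leavitt.isCuntzPair.star_left_mul]
  refine LeavittPath.injective_of_linearIndependent hG (F : LeavittPath k G →ₙₐ[k] Leavitt k)
    (linearIndependent_of_separating f (fun p => ?_) fun p q hpq => ?_)
  · change f p (F _) ≠ 0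
    rw [hf1 p p rfl rfl, Leavitt.star_word_mul_self, hπ0 _ (Leavitt.one_mem_component k)]
    exact one_ne_zero
  · change f p (F _) = 0
    by_cases h1 : p.1.1 = q.1.1
    · by_cases h2 : r p = r q
      · rw [hf1 p q h1 h2]
        obtain ⟨n, hn, hmem⟩ := Leavitt.star_word_mul_word (k := k) hi (h1 ▸ hr p) (hr q)
          fun h => hpq (Subtype.ext (Prod.ext h1 h))
        exact hπ1 n hn _ hmem
      · rw [hf, hs' _ _ (Ne.symm h2)]
        simp
    · rw [hf, hs' _ _ h1]
      simp

theorem mem_tensorComponent_of_mem_component (F : LeavittPath k G →⋆ₙₐ[k] Leavitt k ⊗[k] Leavitt k)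
    (hF : ∀ g, F (LeavittPath.gen k G g) ∈ tensorComponent k g.deg) {n : ℤ} {a : LeavittPath k G}
    (ha : a ∈ LeavittPath.component k G n) : F a ∈ tensorComponent k n := by
  -- `LeavittPath.component` is described by products in the unital algebra, where `F` is not
  -- defined. Nonempty words are rebuilt in the non-unital algebra, starting from one letter.
  have hword : ∀ l : List (PathGen V E), l ≠ [] → ∃ b : LeavittPath k G,
      (b : PathUnital k G) = (l.map (PathUnital.gen k G)).prod ∧
        F b ∈ tensorComponent k (l.map PathGen.deg).sum := by
    intro l
    induction l with
    | nil => exact fun h => (h rfl).elim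
    | cons g l ih =>
      intro _
      by_cases hl : l = []
      · subst hl
        exact ⟨LeavittPath.gen k G g, by simp [LeavittPath.gen], by simpa using hF g⟩
      · obtain ⟨b, hb, hFb⟩ := ih hl
        refine ⟨LeavittPath.gen k G g * b, ?_, ?_⟩
        · rw [List.map_cons, List.prod_cons, ← hb]
          rfl
        · rw [map_mul, List.map_cons, List.sum_cons]
          exact Leavitt.mul_mem_tensorComponent (hF g) hFb
  induction ha using Submodule.span_induction with
  | mem a ha =>
    obtain ⟨l, hl, rfl, hal⟩ := ha
    obtain ⟨b, hb, hFb⟩ := hword l hl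
    rwa [Subtype.ext (hal.trans hb.symm)]
  | zero => rw [map_zero]; exact zero_mem _
  | add a b _ _ ha hb => rw [map_add]; exact add_mem ha hb
  | smul c a _ ha => rw [map_smul]; exact Submodule.smul_mem _ _ ha

/-- Graded uniqueness for homomorphisms to `L_k(1,2) ⊗ L_k(1,2)`. -/
theorem injective_of_graded (hG : G.RowFinite)
    (F : LeavittPath k G →⋆ₙₐ[k] Leavitt k ⊗[k] Leavitt k)
    (hF : ∀ g, F (LeavittPath.gen k G g) ∈ tensorComponent k g.deg)
    (h0 : ∀ v, F (LeavittPath.gen k G (.vert v)) ≠ 0) : Function.Injective F := by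
  obtain ⟨π, hπ0, hπ1⟩ := Leavitt.exists_tensor_proj (k := k)
  have hpath : ∀ v (l : List E), F (LeavittPath.ofPath k G v l) ∈ tensorComponent k l.length := by
    intro v l
    induction l generalizing v with
    | nil => exact hF (.vert v)
    | cons e l ih =>
      rw [LeavittPath.ofPath, map_mul, List.length_cons, Nat.cast_succ, add_comm]
      exact Leavitt.mul_mem_tensorComponent (hF (.edge e)) (ih _)
  refine LeavittPath.injective_of_linearIndependent hG
    (F : LeavittPath k G →ₙₐ[k] Leavitt k ⊗[k] Leavitt k)
    -- The test for `p` is `z ↦ π (F(p)* z)`: on `p` it gives the image of its end vertex, which is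
    -- nonzero of degree `0`.
    (linearIndependent_of_separating (fun p => π ∘ₗ LinearMap.mulLeft k
      (star (F (LeavittPath.ofPath k G p.1.1 p.1.2)))) (fun p => ?_) fun p q hpq => ?_)
  · obtain ⟨w, hw⟩ := p.2
    change π (star (F _) * F _) ≠ 0
    rw [← map_star, ← map_mul, LeavittPath.star_ofPath_mul_self hw, hπ0 _ (hF (.vert w))]
    exact h0 w
  · obtain ⟨w, hw⟩ := p.2
    obtain ⟨w', hw'⟩ := q.2
    change π (star (F _) * F _) = 0
    by_cases hlen : p.1.2.length = q.1.2.length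
    · rw [← map_star, ← map_mul, LeavittPath.star_ofPath_mul_ne hw hw' hlen
        fun h1 h2 => hpq (Subtype.ext (Prod.ext h1 h2)), map_zero, map_zero]
    · exact hπ1 (-(p.1.2.length : ℤ) + q.1.2.length) (by omega) _
        (Leavitt.mul_mem_tensorComponent (Leavitt.star_mem_tensorComponent (hpath _ _))
          (hpath _ _))

/-! ### The twisting unitaries of degree one -/

/-- The element `∑ xᵢ ⊗ s xᵢ* s*`; it is a partial unitary on `1 ⊗ s s*` if `s` is an isometry. -/
noncomputable def Leavitt.partialUnitary (s : Leavitt k) : Leavitt k ⊗[k] Leavitt k :=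
  gen k (.x 0) ⊗ₜ (s * star (gen k (.x 0)) * star s) +
    gen k (.x 1) ⊗ₜ (s * star (gen k (.x 1)) * star s)

namespace Leavitt

theorem partialUnitary_mem (s : Leavitt k) : partialUnitary s ∈ tensorComponent k 1 :=
  add_mem (tmul_mem_tensorComponent (gen_mem_component k (.x 0)) _)
    (tmul_mem_tensorComponent (gen_mem_component k (.x 1)) _)

variable {s : Leavitt k} (hs : star s * s = 1)
include hs

theorem range_mul_partialUnitary :
    (1 ⊗ₜ[k] (s * star s)) * partialUnitary s = partialUnitary s := by
  have hs1 : ∀ c, star s * (s * c) = c := fun c => by rw [← mul_assoc, hs, one_mul]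
  simp only [partialUnitary, mul_add, Algebra.TensorProduct.tmul_mul_tmul, one_mul, mul_assoc, hs1]

theorem partialUnitary_mul_range :
    partialUnitary s * (1 ⊗ₜ[k] (s * star s)) = partialUnitary s := by
  have hs1 : ∀ c, star s * (s * c) = c := fun c => by rw [← mul_assoc, hs, one_mul]
  simp only [partialUnitary, add_mul, Algebra.TensorProduct.tmul_mul_tmul, mul_one, mul_assoc, hs1]

/-- Orthogonality in the first factor removes the cross terms, and `x x* + y y* = 1` collapses the
second factor. -/
theorem star_partialUnitary_mul_self :
    star (partialUnitary s) * partialUnitary s = 1 ⊗ₜ[k] (s * star s) := by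
  have h := isCuntzPair (k := k)
  have hs1 : ∀ c, star s * (s * c) = c := fun c => by rw [← mul_assoc, hs, one_mul]
  simp only [partialUnitary, star_add, TensorProduct.star_tmul, star_mul, star_star, add_mul,
    mul_add, Algebra.TensorProduct.tmul_mul_tmul, h.star_left, h.star_right, h.orthogonal,
    h.orthogonal', TensorProduct.zero_tmul, add_zero, zero_add, mul_assoc, hs1]
  rw [← TensorProduct.tmul_add, ← mul_add, ← mul_assoc, ← mul_assoc (gen k (.x 1)), ← add_mul,
    h.complete, one_mul]

/-- The factors exchange roles: orthogonality acts in the second and completeness in the first. -/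
theorem partialUnitary_mul_star_self :
    partialUnitary s * star (partialUnitary s) = 1 ⊗ₜ[k] (s * star s) := by
  have h := isCuntzPair (k := k)
  have hs1 : ∀ c, star s * (s * c) = c := fun c => by rw [← mul_assoc, hs, one_mul]
  simp only [partialUnitary, star_add, TensorProduct.star_tmul, star_mul, star_star, add_mul,
    mul_add, Algebra.TensorProduct.tmul_mul_tmul, h.star_left_mul, h.star_right_mul,
    h.orthogonal_mul, h.orthogonal_mul', TensorProduct.tmul_zero, add_zero, zero_add, mul_assoc,
    hs1, mul_zero]
  rw [← TensorProduct.add_tmul, h.complete]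

end Leavitt

/-- Partial unitaries supported on orthogonal projections with sum `1` add up to a unitary. -/
theorem sum_mem_unitary {B ι : Type*} [Ring B] [StarRing B] [Fintype ι] {p U : ι → B}
    (hp : ∀ i, star (p i) = p i) (hne : ∀ i j, i ≠ j → p i * p j = 0) (hsum : ∑ i, p i = 1)
    (h1 : ∀ i, p i * U i = U i) (h2 : ∀ i, U i * p i = U i) (h3 : ∀ i, star (U i) * U i = p i)
    (h4 : ∀ i, U i * star (U i) = p i) : ∑ i, U i ∈ unitary B := by
  have h5 : ∀ i j, i ≠ j → star (U i) * U j = 0 := fun i j hij => by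
    rw [← h1 i, ← h1 j, star_mul, hp, mul_assoc, ← mul_assoc (p i), hne i j hij, zero_mul, mul_zero]
  have h6 : ∀ i j, i ≠ j → U i * star (U j) = 0 := fun i j hij => by
    rw [← h2 i, ← h2 j, star_mul, hp, mul_assoc, ← mul_assoc (p i), hne i j hij, zero_mul, mul_zero]
  rw [Unitary.mem_iff, star_sum, Finset.sum_mul_sum, Finset.sum_mul_sum]
  constructor
  · rw [← hsum]
    refine Finset.sum_congr rfl fun i _ => ?_
    rw [Finset.sum_eq_single i (fun j _ hj => h5 i j hj.symm) (by simp), h3]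
  · rw [← hsum]
    refine Finset.sum_congr rfl fun i _ => ?_
    rw [Finset.sum_eq_single i (fun j _ hj => h6 i j hj.symm) (by simp), h4]

end Embedding

/-! ### The embedding theorem -/

theorem theorem4p3 {k : Type u} [Field k] [StarRing k] {V : Type v} {E : Type w}
    [Countable V] [Countable E] (G : DiGraph V E) (hG : G.RowFinite) :
    ∃ (φ : LeavittPath k G →⋆ₙₐ[k] Leavitt k)
      (U : V → Leavitt k ⊗[k] Leavitt k)
      (ψ : LeavittPath k G →⋆ₙₐ[k] Leavitt k ⊗[k] Leavitt k),
      Function.Injective φ ∧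
      (∀ v, U v ∈ tensorComponent k 1 ∧
        (1 ⊗ₜ[k] φ (LeavittPath.gen k G (.vert v))) * U v = U v ∧
        U v * (1 ⊗ₜ[k] φ (LeavittPath.gen k G (.vert v))) = U v ∧
        star (U v) * U v = 1 ⊗ₜ[k] φ (LeavittPath.gen k G (.vert v)) ∧
        U v * star (U v) = 1 ⊗ₜ[k] φ (LeavittPath.gen k G (.vert v))) ∧
      Function.Injective ψ ∧
      (∀ (n : ℤ) (a : LeavittPath k G),
        a ∈ LeavittPath.component k G n → ψ a ∈ tensorComponent k n) ∧
      (∀ v, ψ (LeavittPath.gen k G (.vert v)) = 1 ⊗ₜ[k] φ (LeavittPath.gen k G (.vert v))) ∧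
      (∀ e, ψ (LeavittPath.gen k G (.edge e)) =
        U (G.src e) * (1 ⊗ₜ[k] φ (LeavittPath.gen k G (.edge e)))) ∧
      (∀ [Fintype V],
        (Nonempty V → ∑ v, φ (LeavittPath.gen k G (.vert v)) = 1) ∧
        ∃ u ∈ unitary (Leavitt k ⊗[k] Leavitt k), u ∈ tensorComponent k 1 ∧
          (∀ v, Commute u (1 ⊗ₜ[k] φ (LeavittPath.gen k G (.vert v)))) ∧
          ∀ e, ψ (LeavittPath.gen k G (.edge e)) =
            u * (1 ⊗ₜ[k] φ (LeavittPath.gen k G (.edge e)))) := by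
  obtain ⟨s, hs, hs', hsum⟩ := (Leavitt.isCuntzPair (k := k)).exists_isometries V
  obtain ⟨i, t, hi, htx, ht, ht', htsum⟩ :=
    (Leavitt.isCuntzPair (k := k)).exists_edge_isometries G hG
  have := Leavitt.nontrivial k
  have hCK := isCKFamily_of_isometries hs hs' ht ht' htsum
  let ι : Leavitt k →ₐ[k] Leavitt k ⊗[k] Leavitt k := Algebra.TensorProduct.includeRight
  have hι : Function.Injective ι :=
    Algebra.TensorProduct.includeRight_injective (algebraMap k (Leavitt k)).injective
  have hCK1 := hCK.map ι.toRingHom fun b => by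
    change 1 ⊗ₜ[k] star b = star (1 ⊗ₜ[k] b)
    rw [TensorProduct.star_tmul, star_one]
  have hCK2 := hCK1.twist (U := fun v => Leavitt.partialUnitary (s v))
    (fun v => Leavitt.range_mul_partialUnitary (hs v))
    (fun v => Leavitt.partialUnitary_mul_range (hs v))
    (fun v => Leavitt.star_partialUnitary_mul_self (hs v))
    (fun v => Leavitt.partialUnitary_mul_star_self (hs v))
  obtain ⟨φ, hφv, hφe⟩ := LeavittPath.exists_starLift (k := k) hCK
  obtain ⟨ψ, hψv, hψe⟩ := LeavittPath.exists_starLift (k := k) hCK2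
  have hdeg0 : ∀ b : Leavitt k, 1 ⊗ₜ[k] b ∈ tensorComponent k 0 :=
    Leavitt.tmul_mem_tensorComponent (Leavitt.one_mem_component k)
  have hψedge : ∀ e, ψ (LeavittPath.gen k G (.edge e)) ∈ tensorComponent k 1 := fun e => by
    rw [hψe]
    have h := Leavitt.mul_mem_tensorComponent (Leavitt.partialUnitary_mem (s (G.src e)))
      (hdeg0 (s (G.src e) * t e * star (s (G.rng e))))
    rw [add_zero] at h
    exact h
  have hψdeg : ∀ g, ψ (LeavittPath.gen k G g) ∈ tensorComponent k g.deg := by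
    rintro (v | e | e)
    · rw [hψv]
      exact hdeg0 _
    · exact hψedge e
    · have h : LeavittPath.gen k G (.ghost e) = star (LeavittPath.gen k G (.edge e)) :=
        (LeavittPath.star_gen k G (.edge e)).symm
      rw [h, map_star]
      exact Leavitt.star_mem_tensorComponent (hψedge e)
  refine ⟨φ, fun v => Leavitt.partialUnitary (s v), ψ,
    injective_of_compression hG hs hs' hi htx φ hφv hφe, fun v => ?_,
    injective_of_graded hG ψ hψdeg fun v => ?_,
    fun n a ha => mem_tensorComponent_of_mem_component ψ hψdeg ha, fun v => ?_, fun e => ?_,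
    fun {_} => ⟨fun hne => ?_, ?_⟩⟩
  · rw [hφv]
    exact ⟨Leavitt.partialUnitary_mem _, Leavitt.range_mul_partialUnitary (hs v),
      Leavitt.partialUnitary_mul_range (hs v), Leavitt.star_partialUnitary_mul_self (hs v),
      Leavitt.partialUnitary_mul_star_self (hs v)⟩
  · rw [hψv]
    refine (map_ne_zero_iff ι hι).2 fun h => one_ne_zero (α := Leavitt k) ?_
    calc (1 : Leavitt k) = star (s v) * s v * (star (s v) * s v) := by rw [hs, mul_one]
      _ = star (s v) * (s v * star (s v)) * s v := by noncomm_ring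
      _ = 0 := by rw [h, mul_zero, zero_mul]
  · rw [hψv, hφv]
    rfl
  · rw [hψe, hφe]
    rfl
  · simp only [hφv]
    exact hsum hne
  -- For empty `V` the sum of the partial unitaries would be `0`, so the unitary `∑ xᵢ ⊗ xᵢ*` is
  -- used instead.
  · rcases isEmpty_or_nonempty V with hV | hV
    · have h1 : star (1 : Leavitt k) * 1 = 1 := by rw [star_one, one_mul]
      have h2 : (1 : Leavitt k) * star 1 = 1 := by rw [star_one, one_mul]
      refine ⟨Leavitt.partialUnitary 1, Unitary.mem_iff.2 ⟨?_, ?_⟩, Leavitt.partialUnitary_mem _,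
        fun v => hV.elim v, fun e => hV.elim (G.src e)⟩
      · rw [Leavitt.star_partialUnitary_mul_self h1, h2, Algebra.TensorProduct.one_def]
      · rw [Leavitt.partialUnitary_mul_star_self h1, h2, Algebra.TensorProduct.one_def]
    · have hone : ∑ v, ι (s v * star (s v)) = 1 := by
        rw [← map_sum, hsum hV, map_one]
      have hleft : ∀ v w, v ≠ w →
          Leavitt.partialUnitary (s v) * ι (s w * star (s w)) = 0 := fun v w h => by
        rw [← Leavitt.partialUnitary_mul_range (hs v), mul_assoc]
        exact (congrArg _ (hCK1.vert_ne v w h)).trans (mul_zero _)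
      have hright : ∀ v w, v ≠ w →
          ι (s w * star (s w)) * Leavitt.partialUnitary (s v) = 0 := fun v w h => by
        rw [← Leavitt.range_mul_partialUnitary (hs v), ← mul_assoc]
        exact (congrArg (· * _) (hCK1.vert_ne w v h.symm)).trans (zero_mul _)
      -- Cutting the sum by the projection of `w` on either side leaves the summand of `w`. This
      -- gives the commutation and, with `w = s(e)`, the formula for `ψ(e)`.
      have hsumr : ∀ w, (∑ v, Leavitt.partialUnitary (s v)) * ι (s w * star (s w)) =
          Leavitt.partialUnitary (s w) := fun w => by
        rw [Finset.sum_mul, Finset.sum_eq_single w (fun v _ h => hleft v w h) (by simp)]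
        exact Leavitt.partialUnitary_mul_range (hs w)
      have hsuml : ∀ w, ι (s w * star (s w)) * (∑ v, Leavitt.partialUnitary (s v)) =
          Leavitt.partialUnitary (s w) := fun w => by
        rw [Finset.mul_sum, Finset.sum_eq_single w (fun v _ h => hright v w h) (by simp)]
        exact Leavitt.range_mul_partialUnitary (hs w)
      refine ⟨∑ v, Leavitt.partialUnitary (s v),
        sum_mem_unitary hCK1.star_vert hCK1.vert_ne hone
          (fun v => Leavitt.range_mul_partialUnitary (hs v))
          (fun v => Leavitt.partialUnitary_mul_range (hs v))
          (fun v => Leavitt.star_partialUnitary_mul_self (hs v))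
          (fun v => Leavitt.partialUnitary_mul_star_self (hs v)),
        sum_mem fun v _ => Leavitt.partialUnitary_mem _, fun v => ?_, fun e => ?_⟩
      · rw [hφv]
        exact (hsumr v).trans (hsuml v).symm
      · rw [hψe, hφe, ← hsumr (G.src e), mul_assoc]
        exact congrArg _ (hCK1.src_edge e)
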